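/- All Banach spaces are real. For $k\ge 1$ let $[\mathbb N]^k$ be the set of $k$-element subsets of $\mathbb N=\{1,2,\dots\}$, each written in increasing order, with the Hamming metric $d^{(k)}_{\mathbb H}(\bar m,\bar n)=|\{i: m_i\neq n_i\}|$. For $\mathbb M\subset\mathbb N$, $[\mathbb M]^k$ is the set of $k$-element subsets of $\mathbb M$. A family $(X_i)$ of metric spaces equi-coarsely embeds into a metric space $Y$ if there are nondecreasing $\rho,\omega:[0,\infty)\to[0,\infty)$ with $\lim_{t\to\infty}\rho(t)=\infty$ and maps $f_i:X_i\to Y$ with $\rho(t)\le\inf\{d(f_i(x),f_i(y)):d(x,y)\ge t\}$ and $\sup\{d(f_i(x),f_i(y)):d(x,y)\le t\}\le\omega(t)$ for all $i$ and $t$ ($\inf\emptyset=\infty$, $\sup\emptyset=0$). A Banach space $X$ satisfies the *concentration inequality* if there is $C\ge1$ such that for every $k\ge 1$ and every Lipschitz map $f:([\mathbb N]^k,d^{(k)}_{\mathbb H})\to X$ there is an infinite $\mathbb M\subset\mathbb N$ with $\operatorname{diam} f([\mathbb M]^k)\le C\,\mathrm{Lip}(f)$. $X$ is quasi-reflexive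 of order one if its canonical image in $X^{**}$ has codimension one. Two sequences $(x_j)_{j=1}^k,(y_j)_{j=1}^k$ are $C$-equivalent if there are $A,B>0$ with $AB=C$ and $\frac1A\|\sum a_jx_j\|\le\|\sum a_jy_j\|\le B\|\sum a_jx_j\|$ for all scalars $a_j$. Let $\{X\}_k$ be the set of norms on $\mathbb R^k$ for which the unit vector basis $(e_j)$ is normalized and monotone and such that for every $\varepsilon>0$: for all closed finite-codimensional $X_1\subset X$ there is $x_1\in S_{X_1}$ such that … for all closed finite-codimensional $X_k\subset X$ there is $x_k\in S_{X_k}$ with $(x_j)_{j=1}^k$ $(1+\varepsilon)$-equivalent to $(e_j)_{j=1}^k$. $X$ is asymptotic-$c_0$ if there is $c\ge1$ such that for all $k$ and all $E\in\{X\}_k$ the basis of $E$ is $c$-equivalent to the unit vector basis of $\ell_\infty^k$. Let $T$ be the completion of $c_{00}$ under the norm determined by $\|x\|_T=\max\{\|x\|_\infty,\frac12\sup\sum_{j=1}^n\|E_jx\|_T\}$, the supremum over all $n$ and all finite sets $n\le E_1<\dots<E_n$; let $T^*$ be its dual (Tsirelson's original space) and $(u_i)$ the unit vector basis of $T^*$,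 i.e. the coordinate functionals on $T$. Let $J[(u_i)]$ be the completion of $c_{00}$ under $$\|a\|=\sup\Big\{\Big\|\sum_{i=1}^n\Big(\sum_{j\in s_i}a_j\Big)u_{p_i}\Big\|_{T^*}: n\in\mathbb N,\ s_1<\dots<s_n\text{ intervals in }\mathbb N,\ p_i=\min s_i\Big\}.$$ **Theorem.** The Banach space $J[(u_i)]$ is not reflexive; it is quasi-reflexive of order one and asymptotic-$c_0$; and the family $([\mathbb N]^k,d^{(k)}_{\mathbb H})_{k\in\mathbb N}$ does not equi-coarsely embed into it. In particular there is a non-reflexive Banach space into which the Hamming graphs do not equi-coarsely embed. Moreover the concentration inequality is strictly stronger than non-equi-coarse-embeddability of the Hamming graphs: if a Banach space $Y$ satisfies the concentration inequality, then the Hamming graphs do not equi-coarsely embed into $Y$, whereas $J[(u_i)]$ does not satisfy the concentration inequality although the Hamming graphs do not equi-coarsely embed into it. -/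

import Mathlib

open scoped NNReal ENNReal
open Filter Topology

noncomputable section

/-! ### The Hamming graphs and equi-coarse embeddings -/

/-- The `k`-subsets of the natural numbers, each listed in increasing order
`m 0 < m 1 < … < m (k-1)`, with the Hamming metric: the distance from `m` to `n` is the number
of `i` with `m i ≠ n i` (the metric inherited from Mathlib's `Hamming`). -/
def HammingGraph (k : ℕ) : Type :=
  {m : Hamming (fun _ : Fin k => ℕ) // StrictMono (Hamming.ofHamming m)}

instance (k : ℕ) : MetricSpace (HammingGraph k) :=
  inferInstanceAs (MetricSpace {m : Hamming (fun _ : Fin k => ℕ) // StrictMono (Hamming.ofHamming m)})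

/-- The `i`-th smallest element of a `k`-subset. -/
def HammingGraph.entry {k : ℕ} (m : HammingGraph k) : Fin k → ℕ := Hamming.ofHamming m.1

theorem HammingGraph.dist_eq {k : ℕ} (m n : HammingGraph k) :
    dist m n = ((Finset.univ.filter fun i => m.entry i ≠ n.entry i).card : ℝ) := rfl

/-- The `k`-subsets of the set `M`. -/
def HammingGraph.subsetsOf (k : ℕ) (M : Set ℕ) : Set (HammingGraph k) :=
  {m | ∀ i, m.entry i ∈ M}

/-- `ρ_f(t) = inf {d(f x, f y) : d(x, y) ≥ t}`, with `inf ∅ = ∞`. -/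
def compressionModulus {X Y : Type*} [MetricSpace X] [MetricSpace Y] (f : X → Y) (t : ℝ≥0) :
    ℝ≥0∞ :=
  ⨅ (x : X) (y : X) (_ : t ≤ nndist x y), edist (f x) (f y)

/-- `ω_f(t) = sup {d(f x, f y) : d(x, y) ≤ t}`, with `sup ∅ = 0`. -/
def expansionModulus {X Y : Type*} [MetricSpace X] [MetricSpace Y] (f : X → Y) (t : ℝ≥0) :
    ℝ≥0∞ :=
  ⨆ (x : X) (y : X) (_ : nndist x y ≤ t), edist (f x) (f y)

/-- The family `(X i)` equi-coarsely embeds into `Y`: there are nondecreasing functions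
`ρ, ω : [0,∞) → [0,∞)` with `ρ(t) → ∞` and maps `f i : X i → Y` with `ρ ≤ ρ_{f i}` and
`ω_{f i} ≤ ω` for every `i`. -/
def EquiCoarselyEmbeds {ι : Type*} (X : ι → Type*) [∀ i, MetricSpace (X i)]
    (Y : Type*) [MetricSpace Y] : Prop :=
  ∃ ρ ω : ℝ≥0 → ℝ≥0, Monotone ρ ∧ Monotone ω ∧ Tendsto ρ atTop atTop ∧
    ∃ f : ∀ i, X i → Y, ∀ i t,
      (ρ t : ℝ≥0∞) ≤ compressionModulus (f i) t ∧ expansionModulus (f i) t ≤ (ω t : ℝ≥0∞)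

/-- The Lipschitz constant `Lip(f)`, the supremum of all `d(f x, f y) / d(x, y)`. -/
def lipConst {X Y : Type*} [MetricSpace X] [MetricSpace Y] (f : X → Y) : ℝ :=
  sSup {r : ℝ | ∃ x y : X, 0 < dist x y ∧ r = dist (f x) (f y) / dist x y}

/-- There is `C ≥ 1` such that for all `k ≥ 1` and all Lipschitz `f` from the `k`-th Hamming
graph to `X` there is an infinite set `M` of natural numbers with
`diam f([M]^k) ≤ C Lip(f)`. (The Hamming graph is bounded, hence so is the image of `f`, and
`Metric.diam` is the actual diameter.) -/
def HammingConcentration (X : Type*) [MetricSpace X] : Prop :=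
  ∃ C : ℝ, 1 ≤ C ∧ ∀ (k : ℕ+) (f : HammingGraph k → X), (∃ K : ℝ≥0, LipschitzWith K f) →
    ∃ M : Set ℕ, M.Infinite ∧
      Metric.diam (f '' HammingGraph.subsetsOf k M) ≤ C * lipConst f

/-! ### Reflexivity, quasi-reflexivity, asymptotic structure -/

section BanachProperties

variable (X : Type*) [NormedAddCommGroup X] [NormedSpace ℝ X]

/-- The canonical embedding of `X` into its bidual is onto. -/
def IsReflexiveSpace : Prop :=
  Function.Surjective (NormedSpace.inclusionInDoubleDual ℝ X)

/-- The image of the canonical embedding of `X` into its bidual has finite codimension `d`. -/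
def IsQuasiReflexiveOfOrder (d : ℕ) : Prop :=
  FiniteDimensional ℝ (StrongDual ℝ (StrongDual ℝ X) ⧸
      LinearMap.range (NormedSpace.inclusionInDoubleDual ℝ X).toLinearMap) ∧
    Module.finrank ℝ (StrongDual ℝ (StrongDual ℝ X) ⧸
      LinearMap.range (NormedSpace.inclusionInDoubleDual ℝ X).toLinearMap) = d

/-- The closed subspaces of `X` of finite codimension. -/
def cofiniteSubspaces : Set (Submodule ℝ X) :=
  {Y | IsClosed (Y : Set X) ∧ FiniteDimensional ℝ (X ⧸ Y)}

variable {X}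

/-- The function `a ↦ ‖∑ a i • x i‖`. -/
def combNorm {k : ℕ} (x : Fin k → X) (a : Fin k → ℝ) : ℝ := ‖∑ i, a i • x i‖

/-- `C`-equivalence of two finite sequences `x`, `y` of length `k`, expressed through the
functions `N₁ a = ‖∑ a i x i‖` and `N₂ a = ‖∑ a i y i‖`. -/
def SeqEquivalent {k : ℕ} (C : ℝ) (N₁ N₂ : (Fin k → ℝ) → ℝ) : Prop :=
  ∃ A B : ℝ, 0 < A ∧ 0 < B ∧ C = A * B ∧ ∀ a, 1 / A * N₁ a ≤ N₂ a ∧ N₂ a ≤ B * N₁ a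

variable (X) in
/-- For a condition `P` on sequences of length `k` in `X`: for every closed subspace `X₁` of finite
codimension there is a unit vector `x₁` of `X₁` such that for every such `X₂` there is a unit
vector `x₂` of `X₂`, …, such that for every such `X_k` there is a unit vector `x_k` of `X_k` for
which `(x₁, …, x_k)` satisfies `P`. -/
def VectorChooserWins : (k : ℕ) → ((Fin k → X) → Prop) → Prop
  | 0, P => P Fin.elim0
  | k + 1, P => ∀ Y ∈ cofiniteSubspaces X, ∃ x ∈ Y, ‖x‖ = 1 ∧
      VectorChooserWins k fun xs => P (Fin.cons x xs)

/-- `N` is a norm on `ℝ^k` for which the unit vector basis is normalized and monotone. -/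
structure IsMonotoneBasisNorm {k : ℕ} (N : Seminorm ℝ (Fin k → ℝ)) : Prop where
  definite : ∀ a, N a = 0 → a = 0
  normalized : ∀ i, N (Pi.single i 1) = 1
  monotone : ∀ (a : Fin k → ℝ) (m : ℕ), N (fun i => if (i : ℕ) < m then a i else 0) ≤ N a

variable (X)

/-- The `k`-th asymptotic structure `{X}_k`, a set of norms on `ℝ^k`. -/
def asymptoticStructure (k : ℕ) : Set (Seminorm ℝ (Fin k → ℝ)) :=
  {N | IsMonotoneBasisNorm N ∧ ∀ ε : ℝ, 0 < ε →
    VectorChooserWins X k fun x => SeqEquivalent (1 + ε) (combNorm x) N}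

/-- `X` is asymptotic-`c₀`: for some `c ≥ 1`, for all `k` and all members of the `k`-th asymptotic
structure, the unit vector basis is `c`-equivalent to the unit vector basis of `ℓ_∞^k`
(the norm of `Fin k → ℝ` is the maximum norm). -/
def IsAsymptoticC0 : Prop :=
  ∃ c : ℝ, 1 ≤ c ∧ ∀ k : ℕ, ∀ N ∈ asymptoticStructure X k,
    SeqEquivalent c N (fun a : Fin k → ℝ => ‖a‖)

end BanachProperties

/-! ### Completions of `c₀₀` -/

/-- The space `c₀₀` of finitely supported real sequences, with the (semi)norm `p`. -/
def SeminormedC00 (_p : Seminorm ℝ (ℕ →₀ ℝ)) : Type := ℕ →₀ ℝ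

namespace SeminormedC00

variable (p : Seminorm ℝ (ℕ →₀ ℝ))

instance : AddCommGroup (SeminormedC00 p) := inferInstanceAs (AddCommGroup (ℕ →₀ ℝ))

instance : Module ℝ (SeminormedC00 p) := inferInstanceAs (Module ℝ (ℕ →₀ ℝ))

instance : SeminormedAddCommGroup (SeminormedC00 p) :=
  AddGroupSeminorm.toSeminormedAddCommGroup (E := SeminormedC00 p) p.toAddGroupSeminorm

theorem norm_def (x : SeminormedC00 p) : ‖x‖ = p x := rfl

instance : NormedSpace ℝ (SeminormedC00 p) where
  norm_smul_le c x := (map_smul_eq_mul p c x).le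

end SeminormedC00

/-- The completion of `c₀₀` under the (semi)norm `p`. -/
abbrev C00Completion (p : Seminorm ℝ (ℕ →₀ ℝ)) : Type :=
  UniformSpace.Completion (SeminormedC00 p)

/-- Sums over finitely many disjoint finite sets are at most the sum over all indices. -/
theorem sum_disjoint_le {n : ℕ} (S : Fin n → Finset ℕ) (hS : Pairwise fun i j => Disjoint (S i) (S j))
    (x : ℕ →₀ ℝ) (g : ℕ → ℝ) (hg : ∀ j, 0 ≤ g j) (hx : ∀ j, j ∉ x.support → g j = 0) :
    ∑ i, ∑ j ∈ S i, g j ≤ ∑ j ∈ x.support, g j := by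
  classical
  rw [← Finset.sum_biUnion (fun i _ j _ h => hS h)]
  calc _ = ∑ j ∈ (Finset.univ.biUnion S).filter (· ∈ x.support), g j :=
        (Finset.sum_filter_of_ne fun j _ hj => by
          by_contra h
          exact hj (hx j h)).symm
    _ ≤ _ := Finset.sum_le_sum_of_subset_of_nonneg
        (fun j hj => (Finset.mem_filter.1 hj).2) fun j _ _ => hg j

/-! ### Tsirelson's space `T`, its dual `T*`, and the unit vector basis of `T*`

Sequences are indexed by `ℕ = {0, 1, 2, …}`: the index `a` stands for the coordinate `a + 1` of a
sequence indexed by `1, 2, 3, …`. -/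

/-- An admissible family `n ≤ E 0 < E 1 < ⋯ < E (n-1)` of finite sets (the index `a` stands for
the positive integer `a + 1`). Empty members and the empty family contribute nothing below. -/
structure AdmissibleFamily where
  n : ℕ
  E : Fin n → Finset ℕ
  lt : ∀ i j, i < j → ∀ a ∈ E i, ∀ b ∈ E j, a < b
  le : ∀ i, ∀ a ∈ E i, n ≤ a + 1

instance : Nonempty AdmissibleFamily :=
  ⟨⟨0, fun _ => ∅, fun _ _ _ _ h => by simp at h, fun _ _ h => by simp at h⟩⟩

theorem AdmissibleFamily.disjoint (A : AdmissibleFamily) :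
    Pairwise fun i j => Disjoint (A.E i) (A.E j) := by
  intro i j hij
  rw [Finset.disjoint_left]
  intro a hi hj
  rcases lt_or_gt_of_ne hij with h | h
  · exact lt_irrefl _ (A.lt i j h a hi a hj)
  · exact lt_irrefl _ (A.lt j i h a hj a hi)

/-- The restriction `Ex` of `x` to the coordinates in `E`. -/
def restrictTo (E : Finset ℕ) (x : ℕ →₀ ℝ) : ℕ →₀ ℝ := x.filter (· ∈ E)

/-- The iterative construction of the norm of `T`: `‖x‖₀ = ‖x‖_∞` and
`‖x‖_{m+1} = max (‖x‖_m, ½ sup ∑ ‖E_j x‖_m)`, the supremum over all admissible `(E_j)`. -/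
def tsirelsonStage : ℕ → (ℕ →₀ ℝ) → ℝ
  | 0, x => ⨆ i, |x i|
  | m + 1, x => max (tsirelsonStage m x)
      (1 / 2 * ⨆ A : AdmissibleFamily, ∑ j, tsirelsonStage m (restrictTo (A.E j) x))

/-- The norm of `T` on `c₀₀`. -/
def tsirelsonNorm (x : ℕ →₀ ℝ) : ℝ := ⨆ m, tsirelsonStage m x

theorem abs_le_l1 (x : ℕ →₀ ℝ) (i : ℕ) : |x i| ≤ ∑ j ∈ x.support, |x j| := by
  by_cases h : i ∈ x.support
  · exact Finset.single_le_sum (f := fun j => |x j|) (fun _ _ => abs_nonneg _) h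
  · rw [Finsupp.notMem_support_iff.1 h, abs_zero]
    exact Finset.sum_nonneg fun _ _ => abs_nonneg _

theorem sum_l1_restrictTo (E : Finset ℕ) (x : ℕ →₀ ℝ) :
    ∑ j ∈ (restrictTo E x).support, |restrictTo E x j| ≤ ∑ j ∈ E, |x j| := by
  calc ∑ j ∈ (restrictTo E x).support, |restrictTo E x j|
      = ∑ j ∈ (restrictTo E x).support, |x j| := by
        refine Finset.sum_congr rfl fun j hj => ?_
        have : j ∈ E := by
          simp only [restrictTo, Finsupp.support_filter, Finset.mem_filter] at hj
          exact hj.2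
        simp [restrictTo, this]
    _ ≤ ∑ j ∈ E, |x j| := by
        refine Finset.sum_le_sum_of_subset_of_nonneg ?_ fun _ _ _ => abs_nonneg _
        intro j hj
        simp only [restrictTo, Finsupp.support_filter, Finset.mem_filter] at hj
        exact hj.2

theorem tsirelsonStage_nonneg_le (m : ℕ) : ∀ x : ℕ →₀ ℝ,
    0 ≤ tsirelsonStage m x ∧ tsirelsonStage m x ≤ ∑ j ∈ x.support, |x j| := by
  induction m with
  | zero =>
    intro x
    exact ⟨Real.iSup_nonneg fun i => abs_nonneg _, ciSup_le (abs_le_l1 x)⟩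
  | succ m ih =>
    intro x
    refine ⟨le_max_of_le_left (ih x).1, max_le (ih x).2 ?_⟩
    have hb : (⨆ A : AdmissibleFamily, ∑ j, tsirelsonStage m (restrictTo (A.E j) x)) ≤
        ∑ j ∈ x.support, |x j| := by
      refine ciSup_le fun A => ?_
      calc ∑ j, tsirelsonStage m (restrictTo (A.E j) x) ≤ ∑ j, ∑ l ∈ A.E j, |x l| :=
            Finset.sum_le_sum fun j _ => (ih _).2.trans (sum_l1_restrictTo _ _)
        _ ≤ _ := sum_disjoint_le A.E A.disjoint x _ (fun _ => abs_nonneg _)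
            (fun j hj => by rw [Finsupp.notMem_support_iff.1 hj, abs_zero])
    have h0 : 0 ≤ ∑ j ∈ x.support, |x j| := Finset.sum_nonneg fun _ _ => abs_nonneg _
    linarith

theorem bddAbove_admissible (N : (ℕ →₀ ℝ) → ℝ) (hN : ∀ x, N x ≤ ∑ j ∈ x.support, |x j|)
    (x : ℕ →₀ ℝ) :
    BddAbove (Set.range fun A : AdmissibleFamily => ∑ j, N (restrictTo (A.E j) x)) := by
  refine ⟨∑ j ∈ x.support, |x j|, ?_⟩
  rintro _ ⟨A, rfl⟩
  calc ∑ j, N (restrictTo (A.E j) x) ≤ ∑ j, ∑ l ∈ A.E j, |x l| :=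
        Finset.sum_le_sum fun j _ => (hN _).trans (sum_l1_restrictTo _ _)
    _ ≤ _ := sum_disjoint_le A.E A.disjoint x _ (fun _ => abs_nonneg _)
        (fun j hj => by rw [Finsupp.notMem_support_iff.1 hj, abs_zero])

theorem tsirelsonStage_add_le (m : ℕ) : ∀ x y : ℕ →₀ ℝ,
    tsirelsonStage m (x + y) ≤ tsirelsonStage m x + tsirelsonStage m y := by
  induction m with
  | zero =>
    intro x y
    have hb : ∀ z : ℕ →₀ ℝ, BddAbove (Set.range fun i => |z i|) := fun z =>
      ⟨_, by rintro _ ⟨i, rfl⟩; exact abs_le_l1 z i⟩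
    refine ciSup_le fun i => ?_
    rw [Finsupp.add_apply]
    exact (abs_add_le _ _).trans (add_le_add (le_ciSup (hb x) i) (le_ciSup (hb y) i))
  | succ m ih =>
    intro x y
    have hb := bddAbove_admissible (tsirelsonStage m) fun z => (tsirelsonStage_nonneg_le m z).2
    refine max_le ((ih x y).trans (add_le_add (le_max_left _ _) (le_max_left _ _))) ?_
    have h : (⨆ A : AdmissibleFamily, ∑ j, tsirelsonStage m (restrictTo (A.E j) (x + y))) ≤
        (⨆ A : AdmissibleFamily, ∑ j, tsirelsonStage m (restrictTo (A.E j) x)) +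
          ⨆ A : AdmissibleFamily, ∑ j, tsirelsonStage m (restrictTo (A.E j) y) := by
      refine ciSup_le fun A => ?_
      calc ∑ j, tsirelsonStage m (restrictTo (A.E j) (x + y))
          ≤ ∑ j, (tsirelsonStage m (restrictTo (A.E j) x) +
              tsirelsonStage m (restrictTo (A.E j) y)) := by
            refine Finset.sum_le_sum fun j _ => ?_
            have : restrictTo (A.E j) (x + y) = restrictTo (A.E j) x + restrictTo (A.E j) y :=
              Finsupp.filter_add
            rw [this]
            exact ih _ _
        _ = _ := Finset.sum_add_distrib
        _ ≤ _ := add_le_add (le_ciSup (hb x) A) (le_ciSup (hb y) A)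
    calc _ ≤ 1 / 2 * _ := mul_le_mul_of_nonneg_left h (by norm_num)
      _ = _ := mul_add _ _ _
      _ ≤ _ := add_le_add (le_max_right _ _) (le_max_right _ _)

theorem tsirelsonStage_smul (m : ℕ) : ∀ (c : ℝ) (x : ℕ →₀ ℝ),
    tsirelsonStage m (c • x) = |c| * tsirelsonStage m x := by
  induction m with
  | zero =>
    intro c x
    simp only [tsirelsonStage, Finsupp.smul_apply, smul_eq_mul, abs_mul]
    exact (Real.mul_iSup_of_nonneg (abs_nonneg c) _).symm
  | succ m ih =>
    intro c x
    have h : ∀ E : Finset ℕ, restrictTo E (c • x) = c • restrictTo E x := fun E =>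
      Finsupp.filter_smul
    simp only [tsirelsonStage, h, ih, ← Finset.mul_sum]
    rw [← Real.mul_iSup_of_nonneg (abs_nonneg c), mul_max_of_nonneg _ _ (abs_nonneg c)]
    ring_nf

theorem bddAbove_tsirelsonStage (x : ℕ →₀ ℝ) :
    BddAbove (Set.range fun m => tsirelsonStage m x) :=
  ⟨_, by rintro _ ⟨m, rfl⟩; exact (tsirelsonStage_nonneg_le m x).2⟩

theorem tsirelsonStage_le_norm (m : ℕ) (x : ℕ →₀ ℝ) : tsirelsonStage m x ≤ tsirelsonNorm x :=
  le_ciSup (bddAbove_tsirelsonStage x) m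

/-- The norm of `T` satisfies its implicit formula. -/
theorem tsirelsonNorm_eq (x : ℕ →₀ ℝ) :
    tsirelsonNorm x = max (⨆ i, |x i|)
      (1 / 2 * ⨆ A : AdmissibleFamily, ∑ j, tsirelsonNorm (restrictTo (A.E j) x)) := by
  have hle : ∀ z, tsirelsonNorm z ≤ ∑ j ∈ z.support, |z j| := fun z =>
    ciSup_le fun m => (tsirelsonStage_nonneg_le m z).2
  apply le_antisymm
  · refine ciSup_le fun m => ?_
    induction m with
    | zero => exact le_max_left _ _
    | succ m ih =>
      refine max_le ih (le_max_of_le_right ?_)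
      refine mul_le_mul_of_nonneg_left ?_ (by norm_num)
      exact ciSup_mono (bddAbove_admissible _ hle x) fun A =>
        Finset.sum_le_sum fun j _ => tsirelsonStage_le_norm m _
  · refine max_le (tsirelsonStage_le_norm 0 x) ?_
    have h : (⨆ A : AdmissibleFamily, ∑ j, tsirelsonNorm (restrictTo (A.E j) x)) ≤
        2 * tsirelsonNorm x := by
      refine ciSup_le fun A => ?_
      have hmono : ∀ z, Monotone fun m => tsirelsonStage m z := fun z =>
        monotone_nat_of_le_succ fun m => le_max_left _ _
      have ht : Tendsto (fun m => ∑ j, tsirelsonStage m (restrictTo (A.E j) x)) atTop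
          (𝓝 (∑ j, tsirelsonNorm (restrictTo (A.E j) x))) :=
        tendsto_finsetSum _ fun j _ => tendsto_atTop_ciSup (hmono _) (bddAbove_tsirelsonStage _)
      refine le_of_tendsto' ht fun m => ?_
      have h1 := le_ciSup (bddAbove_admissible (tsirelsonStage m)
        (fun z => (tsirelsonStage_nonneg_le m z).2) x) A
      have h2 : 1 / 2 * (⨆ A : AdmissibleFamily, ∑ j, tsirelsonStage m (restrictTo (A.E j) x)) ≤
          tsirelsonStage (m + 1) x := le_max_right _ _
      have h3 := tsirelsonStage_le_norm (m + 1) x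
      linarith
    linarith

/-- The norm of `T` as a seminorm on `c₀₀`. -/
def tsirelsonSeminorm : Seminorm ℝ (ℕ →₀ ℝ) :=
  Seminorm.of tsirelsonNorm
    (fun x y => ciSup_le fun m => (tsirelsonStage_add_le m x y).trans
      (add_le_add (tsirelsonStage_le_norm m x) (tsirelsonStage_le_norm m y)))
    (fun c x => by
      simp only [tsirelsonNorm, tsirelsonStage_smul, Real.norm_eq_abs]
      exact (Real.mul_iSup_of_nonneg (abs_nonneg c) _).symm)

/-- Tsirelson's space `T` (in the notation of Figiel and Johnson). -/
abbrev TsirelsonSpace : Type := C00Completion tsirelsonSeminorm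

/-- The space `T*` originally constructed by Tsirelson, the dual of `T`. -/
abbrev TsirelsonDual : Type := StrongDual ℝ TsirelsonSpace

theorem abs_apply_le_tsirelsonNorm (x : ℕ →₀ ℝ) (i : ℕ) : |x i| ≤ tsirelsonNorm x :=
  (le_ciSup (f := fun i => |x i|) ⟨_, by rintro _ ⟨i, rfl⟩; exact abs_le_l1 x i⟩ i).trans
    (tsirelsonStage_le_norm 0 x)

/-- The `i`-th coordinate functional on `c₀₀`, bounded for the norm of `T`. -/
def tsirelsonCoord (i : ℕ) : SeminormedC00 tsirelsonSeminorm →L[ℝ] ℝ :=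
  LinearMap.mkContinuous
    (E := SeminormedC00 tsirelsonSeminorm) (Finsupp.lapply (R := ℝ) (M := ℝ) i) 1
    (fun x => by rw [one_mul]; exact abs_apply_le_tsirelsonNorm x i)

/-- The unit vector basis of `T*`: the coordinate functionals on `T`. -/
def tsirelsonDualBasis (i : ℕ) : TsirelsonDual :=
  (tsirelsonCoord i).extend UniformSpace.Completion.toComplL

theorem tsirelsonDualBasis_apply (i : ℕ) (x : SeminormedC00 tsirelsonSeminorm) :
    tsirelsonDualBasis i (x : TsirelsonSpace) = (show ℕ →₀ ℝ from x) i :=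
  ContinuousLinearMap.extend_eq (tsirelsonCoord i)
    (e := UniformSpace.Completion.toComplL) UniformSpace.Completion.denseRange_coe
    (UniformSpace.Completion.isUniformInducing_coe _) x

/-! ### The James-type space `J[(u_i)]` -/

/-- Finite intervals `s_i = [p i, q i]` of natural numbers with `s_0 < s_1 < ⋯ < s_{n-1}`. -/
structure IntervalChain where
  n : ℕ
  p : Fin n → ℕ
  q : Fin n → ℕ
  le : ∀ i, p i ≤ q i
  lt : ∀ i j, i < j → q i < p j

instance : Nonempty IntervalChain :=
  ⟨⟨0, fun _ => 0, fun _ => 0, fun _ => le_rfl, fun i => i.elim0⟩⟩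

section James

variable {X : Type*} [NormedAddCommGroup X] [NormedSpace ℝ X]

/-- The vector `∑_i (∑_{j ∈ s_i} a_j) u_{p_i}`, where `p_i = min s_i`. -/
def IntervalChain.vec (u : ℕ → X) (s : IntervalChain) (a : ℕ →₀ ℝ) : X :=
  ∑ i, (∑ j ∈ Finset.Icc (s.p i) (s.q i), a j) • u (s.p i)

/-- The norm of `J[(u_i)]` on `c₀₀`. -/
def jamesNorm (u : ℕ → X) (a : ℕ →₀ ℝ) : ℝ := ⨆ s : IntervalChain, ‖s.vec u a‖

theorem IntervalChain.vec_add (u : ℕ → X) (s : IntervalChain) (a b : ℕ →₀ ℝ) :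
    s.vec u (a + b) = s.vec u a + s.vec u b := by
  simp [IntervalChain.vec, Finset.sum_add_distrib, add_smul]

theorem IntervalChain.vec_smul (u : ℕ → X) (s : IntervalChain) (c : ℝ) (a : ℕ →₀ ℝ) :
    s.vec u (c • a) = c • s.vec u a := by
  simp [IntervalChain.vec, Finset.smul_sum, ← Finset.mul_sum, mul_smul]

theorem bddAbove_james (u : ℕ → X) (a : ℕ →₀ ℝ) :
    BddAbove (Set.range fun s : IntervalChain => ‖s.vec u a‖) := by
  refine ⟨∑ j ∈ a.support, |a j| * ∑ l ∈ Finset.range (j + 1), ‖u l‖, ?_⟩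
  rintro _ ⟨s, rfl⟩
  have hdis : Pairwise fun i j =>
      Disjoint (Finset.Icc (s.p i) (s.q i)) (Finset.Icc (s.p j) (s.q j)) := by
    intro i j hij
    rw [Finset.disjoint_left]
    intro l hi hj
    rw [Finset.mem_Icc] at hi hj
    rcases lt_or_gt_of_ne hij with h | h
    · have := s.lt i j h; omega
    · have := s.lt j i h; omega
  calc ‖s.vec u a‖ ≤ ∑ i, ∑ j ∈ Finset.Icc (s.p i) (s.q i),
          |a j| * ∑ l ∈ Finset.range (j + 1), ‖u l‖ := by
        refine (norm_sum_le _ _).trans (Finset.sum_le_sum fun i _ => ?_)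
        rw [norm_smul, Real.norm_eq_abs]
        refine (mul_le_mul_of_nonneg_right (Finset.abs_sum_le_sum_abs _ _)
          (norm_nonneg _)).trans ?_
        rw [Finset.sum_mul]
        refine Finset.sum_le_sum fun j hj => mul_le_mul_of_nonneg_left ?_ (abs_nonneg _)
        rw [Finset.mem_Icc] at hj
        exact Finset.single_le_sum (f := fun l => ‖u l‖) (fun _ _ => norm_nonneg _)
          (Finset.mem_range.2 (by omega))
    _ ≤ _ := sum_disjoint_le _ hdis a _
        (fun j => mul_nonneg (abs_nonneg _) (Finset.sum_nonneg fun _ _ => norm_nonneg _))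
        (fun j hj => by rw [Finsupp.notMem_support_iff.1 hj, abs_zero, zero_mul])

/-- The norm of `J[(u_i)]` as a seminorm on `c₀₀`. -/
def jamesSeminorm (u : ℕ → X) : Seminorm ℝ (ℕ →₀ ℝ) :=
  Seminorm.of (jamesNorm u)
    (fun a b => ciSup_le fun s => by
      rw [s.vec_add]
      exact (norm_add_le _ _).trans
        (add_le_add (le_ciSup (bddAbove_james u a) s) (le_ciSup (bddAbove_james u b) s)))
    (fun c a => by
      simp only [jamesNorm, IntervalChain.vec_smul, norm_smul]
      exact (Real.mul_iSup_of_nonneg (norm_nonneg c) _).symm)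

/-- The space `J[(u_i)]`. -/
abbrev JamesSpace (u : ℕ → X) : Type := C00Completion (jamesSeminorm u)

end James

/-- The space `J[(u_i)]` for the unit vector basis `(u_i)` of `T*`. -/
abbrev JamesTsirelson : Type := JamesSpace tsirelsonDualBasis

end

/-! ### The norm of `T` on `c₀₀` -/

/-! Two facts about Tsirelson's spaces carry the proof. In `T*`, a sum of `k` successive blocks
supported beyond `k` has norm at most twice the largest block norm (`norm_dualComb_biUnion_le`),
because the supports form an admissible family. And the basis of `T` is shrinking
(`tsirelson_shrinking`), by the Figiel–Johnson averaging estimate.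

Shrinking makes the basis of `J[(u_i)]` boundedly complete (`exists_seq_eq_of_bounded`), so bounded
families have coordinatewise ultrafilter limits inside the space. The `T*` estimate shows that `k`
successive blocks beyond `k` behave like the basis of `ℓ_∞^k`, provided that each is null, i.e. its
coordinates add up to `0` (`jamesNorm_sum_nullBlocks_le`): an interval then feels only the blocks
cut by its endpoints. The summing functional `total` is thus the only obstruction to `c₀` behaviour.

Duality: a functional that stays large on late null blocks would be unbounded on their sums, so the
dual is the closed span of the coordinates and `total`. A bidual element has the coordinates of a
vector of the space, and its value at `total` is one further free parameter; this gives
quasi-reflexivity of order one. In the asymptotic game, the subspaces `tailKernel L` force the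
vectors to be nearly null blocks, which gives asymptotic-`c₀`.

Hamming graphs: let `f` move by at most `W` when one entry changes. Minus its iterated
coordinatewise limit, `f` is a sum of `k` increments of norm at most `W`. These tend to `0` in each
coordinate, but their totals may have nonzero limits. Subtracting the increments of two vertices
chosen alternately, `m₁ < n₁ < m₂ < n₂ < ⋯`, cancels these limits and leaves nearly null blocks
(`exists_increasing_pair`). So two vertices at Hamming distance `k` have images at distance bounded
independently of `k`.

The alternation matters: sending a set to the sum of its unit vectors is `2`-Lipschitz, yet if all
of `m` precedes all of `n` the images are at distance at least `k`. Every infinite set contains such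
pairs, so concentration fails. Conversely, concentration applied to one such pair already bounds the
compression modulus. -/

theorem restrictTo_apply (E : Finset ℕ) (x : ℕ →₀ ℝ) (i : ℕ) :
    restrictTo E x i = if i ∈ E then x i else 0 := by
  simp [restrictTo, Finsupp.filter_apply]

theorem restrictTo_add (E : Finset ℕ) (x y : ℕ →₀ ℝ) :
    restrictTo E (x + y) = restrictTo E x + restrictTo E y := Finsupp.filter_add

theorem restrictTo_smul (E : Finset ℕ) (c : ℝ) (x : ℕ →₀ ℝ) :
    restrictTo E (c • x) = c • restrictTo E x := Finsupp.filter_smul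

theorem restrictTo_sum {ι : Type*} (E : Finset ℕ) (s : Finset ι) (x : ι → ℕ →₀ ℝ) :
    restrictTo E (∑ i ∈ s, x i) = ∑ i ∈ s, restrictTo E (x i) := by
  ext j
  simp only [restrictTo_apply, Finsupp.finsetSum_apply]
  split_ifs <;> simp

theorem restrictTo_comm (E F : Finset ℕ) (x : ℕ →₀ ℝ) :
    restrictTo E (restrictTo F x) = restrictTo F (restrictTo E x) := by
  ext j
  simp only [restrictTo_apply]
  split_ifs <;> rfl

theorem tsirelsonNorm_add_le (x y : ℕ →₀ ℝ) :
    tsirelsonNorm (x + y) ≤ tsirelsonNorm x + tsirelsonNorm y :=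
  map_add_le_add tsirelsonSeminorm x y

theorem tsirelsonNorm_smul (c : ℝ) (x : ℕ →₀ ℝ) :
    tsirelsonNorm (c • x) = |c| * tsirelsonNorm x :=
  map_smul_eq_mul tsirelsonSeminorm c x

theorem tsirelsonNorm_zero : tsirelsonNorm 0 = 0 := map_zero tsirelsonSeminorm

theorem tsirelsonNorm_nonneg (x : ℕ →₀ ℝ) : 0 ≤ tsirelsonNorm x :=
  apply_nonneg tsirelsonSeminorm x

theorem tsirelsonNorm_sum_le {ι : Type*} (s : Finset ι) (x : ι → ℕ →₀ ℝ) :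
    tsirelsonNorm (∑ i ∈ s, x i) ≤ ∑ i ∈ s, tsirelsonNorm (x i) := by
  classical
  induction s using Finset.induction_on with
  | empty => simp [tsirelsonNorm_zero]
  | insert a s ha ih =>
    rw [Finset.sum_insert ha, Finset.sum_insert ha]
    exact (tsirelsonNorm_add_le _ _).trans (by gcongr)

theorem tsirelsonNorm_le_l1 (x : ℕ →₀ ℝ) : tsirelsonNorm x ≤ ∑ j ∈ x.support, |x j| :=
  ciSup_le fun m => (tsirelsonStage_nonneg_le m x).2

theorem tsirelsonStage_restrictTo_le (m : ℕ) : ∀ (E : Finset ℕ) (x : ℕ →₀ ℝ),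
    tsirelsonStage m (restrictTo E x) ≤ tsirelsonStage m x := by
  induction m with
  | zero =>
    intro E x
    have hb : BddAbove (Set.range fun i => |x i|) :=
      ⟨_, by rintro _ ⟨i, rfl⟩; exact abs_le_l1 x i⟩
    refine ciSup_le fun i => ?_
    rw [restrictTo_apply]
    split_ifs with h
    · exact le_ciSup hb i
    · rw [abs_zero]
      exact (abs_nonneg _).trans (le_ciSup hb i)
  | succ m ih =>
    intro E x
    refine max_le_max (ih E x) (mul_le_mul_of_nonneg_left ?_ (by norm_num))
    refine ciSup_mono (bddAbove_admissible (tsirelsonStage m)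
        (fun z => (tsirelsonStage_nonneg_le m z).2) x) fun A => Finset.sum_le_sum fun j _ => ?_
    rw [restrictTo_comm]
    exact ih _ _

theorem tsirelsonNorm_restrictTo_le (E : Finset ℕ) (x : ℕ →₀ ℝ) :
    tsirelsonNorm (restrictTo E x) ≤ tsirelsonNorm x :=
  ciSup_le fun m => (tsirelsonStage_restrictTo_le m E x).trans (tsirelsonStage_le_norm m x)

theorem AdmissibleFamily.sum_le (A : AdmissibleFamily) (x : ℕ →₀ ℝ) :
    ∑ j, tsirelsonNorm (restrictTo (A.E j) x) ≤ 2 * tsirelsonNorm x := by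
  have h1 := le_ciSup (bddAbove_admissible _ tsirelsonNorm_le_l1 x) A
  have h2 := tsirelsonNorm_eq x
  have h3 := le_max_right (⨆ i, |x i|)
    (1 / 2 * ⨆ A : AdmissibleFamily, ∑ j, tsirelsonNorm (restrictTo (A.E j) x))
  rw [← h2] at h3
  linarith

theorem tsirelsonNorm_le_of (x : ℕ →₀ ℝ) (C : ℝ) (h : ∀ i, |x i| ≤ C)
    (hA : ∀ A : AdmissibleFamily, ∑ j, tsirelsonNorm (restrictTo (A.E j) x) ≤ 2 * C) :
    tsirelsonNorm x ≤ C := by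
  rw [tsirelsonNorm_eq]
  refine max_le (ciSup_le h) ?_
  have := ciSup_le hA
  linarith

theorem tsirelsonNorm_single (i : ℕ) (c : ℝ) : tsirelsonNorm (Finsupp.single i c) = |c| := by
  apply le_antisymm
  · refine (tsirelsonNorm_le_l1 _).trans ?_
    refine (Finset.sum_le_sum_of_subset_of_nonneg Finsupp.support_single_subset
      fun _ _ _ => abs_nonneg _).trans ?_
    simp
  · simpa using abs_apply_le_tsirelsonNorm (Finsupp.single i c) i

/-! ### The Figiel–Johnson estimate and the shrinking basis of `T` -/

/-- The Figiel–Johnson estimate: averages of many successive blocks cannot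
`ℓ₁`-add to a vector that precedes them. -/
theorem tsirelsonNorm_add_average_le (n₀ r : ℕ) (hr : 0 < r) (y₀ : ℕ →₀ ℝ) (y : Fin r → ℕ →₀ ℝ)
    (ℓ : ℕ → ℕ) (hℓ : Monotone ℓ) (h0 : n₀ ≤ ℓ 0)
    (hy₀ : ∀ a, n₀ ≤ a → y₀ a = 0)
    (hy : ∀ (i : Fin r) a, y i a ≠ 0 → ℓ i ≤ a ∧ a < ℓ (i + 1))
    (hN₀ : tsirelsonNorm y₀ ≤ 1) (hN : ∀ i, tsirelsonNorm (y i) ≤ 1) :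
    tsirelsonNorm (y₀ + (1 / r : ℝ) • ∑ i, y i) ≤ 3 / 2 + n₀ / (2 * r) := by
  classical
  have hr' : (0 : ℝ) < r := by exact_mod_cast hr
  have hquot : (0 : ℝ) ≤ n₀ / (2 * r) := by positivity
  set w : ℕ →₀ ℝ := (1 / r : ℝ) • ∑ i, y i with hw
  have hwN : tsirelsonNorm w ≤ 1 := by
    rw [hw, tsirelsonNorm_smul, abs_of_pos (by positivity)]
    have : tsirelsonNorm (∑ i, y i) ≤ r := by
      refine (tsirelsonNorm_sum_le _ _).trans ((Finset.sum_le_sum fun i _ => hN i).trans ?_)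
      simp
    rw [one_div_mul_eq_div, div_le_one hr']
    exact this
  have hw0 : ∀ a, a < n₀ → w a = 0 := by
    intro a ha
    have : ∀ i, y i a = 0 := fun i => by
      by_contra h
      have := (hy i a h).1
      have := hℓ (Nat.zero_le i.1)
      omega
    simp [hw, this]
  refine tsirelsonNorm_le_of _ _ (fun a => ?_) fun A => ?_
  · rw [Finsupp.add_apply]
    rcases lt_or_ge a n₀ with h | h
    · rw [hw0 a h, add_zero]
      linarith [abs_apply_le_tsirelsonNorm y₀ a]
    · rw [hy₀ a h, zero_add]
      linarith [abs_apply_le_tsirelsonNorm w a]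
  -- A family with more than `n₀` members lives on indices at least `n₀` (index `a` stands for `a +
  -- 1`), so it misses `y₀`. Smaller families are handled by counting how often their members meet
  -- the blocks.
  · rcases lt_or_ge n₀ A.n with hn | hn
    · have hz : ∀ j, restrictTo (A.E j) (y₀ + w) = restrictTo (A.E j) w := by
        intro j
        ext a
        simp only [restrictTo_apply, Finsupp.add_apply]
        split_ifs with ha
        · have := A.le j a ha
          rw [hy₀ a (by omega), zero_add]
        · rfl
      simp only [hz]
      have := A.sum_le w
      linarith
    · have h1 : ∑ j, tsirelsonNorm (restrictTo (A.E j) (y₀ + w)) ≤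
          ∑ j, tsirelsonNorm (restrictTo (A.E j) y₀) +
            ∑ j, tsirelsonNorm (restrictTo (A.E j) w) := by
        rw [← Finset.sum_add_distrib]
        refine Finset.sum_le_sum fun j _ => ?_
        rw [restrictTo_add]
        exact tsirelsonNorm_add_le _ _
      have h2 := A.sum_le y₀
      have h3 : ∑ j, tsirelsonNorm (restrictTo (A.E j) w) ≤
          (1 / r) * ∑ j, ∑ i, tsirelsonNorm (restrictTo (A.E j) (y i)) := by
        rw [Finset.mul_sum]
        refine Finset.sum_le_sum fun j _ => ?_
        rw [hw, restrictTo_smul, restrictTo_sum, tsirelsonNorm_smul, abs_of_pos (by positivity)]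
        exact mul_le_mul_of_nonneg_left (tsirelsonNorm_sum_le _ _) (by positivity)
      set I : Finset (Fin A.n × Fin r) :=
        Finset.univ.filter fun p => restrictTo (A.E p.1) (y p.2) ≠ 0 with hI
      have h4 : ∑ j, ∑ i, tsirelsonNorm (restrictTo (A.E j) (y i)) ≤ I.card := by
        rw [← Finset.sum_product', Finset.univ_product_univ, hI, Finset.card_filter]
        push_cast
        refine Finset.sum_le_sum fun p _ => ?_
        split_ifs with h
        · exact (tsirelsonNorm_restrictTo_le _ _).trans (hN _)
        · rw [not_not] at h
          rw [h, tsirelsonNorm_zero]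
      have hmem : ∀ p ∈ I, ∃ a ∈ A.E p.1, ℓ p.2 ≤ a ∧ a < ℓ (p.2 + 1) := by
        intro p hp
        have hp' := (Finset.mem_filter.1 hp).2
        obtain ⟨a, ha⟩ := Finsupp.ne_iff.1 hp'
        rw [restrictTo_apply] at ha
        by_cases haE : a ∈ A.E p.1
        · rw [if_pos haE] at ha
          exact ⟨a, haE, hy _ _ ha⟩
        · simp [haE] at ha
      have key : ∀ p ∈ I, ∀ p' ∈ I, p.2 < p'.2 → p.1 ≤ p'.1 := by
        intro p hp p' hp' h
        by_contra hlt
        push Not at hlt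
        obtain ⟨a, ha, ha1, ha2⟩ := hmem p hp
        obtain ⟨b, hb, hb1, hb2⟩ := hmem p' hp'
        have h5 := A.lt _ _ hlt b hb a ha
        have h6 : ℓ (p.2 + 1) ≤ ℓ p'.2 := hℓ (by have : (p.2 : ℕ) < p'.2 := h; omega)
        omega
      -- The pairs (member, block) that meet form a staircase, since both families are successive.
      -- Along a staircase the sum of the two indices is injective, so there are at most `A.n + r`
      -- pairs instead of `A.n * r`.
      have h5 : I.card ≤ (Finset.range (A.n + r)).card := by
        refine Finset.card_le_card_of_injOn (fun p => (p.1 : ℕ) + p.2) ?_ ?_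
        · intro p _
          simp only [Finset.coe_range, Set.mem_Iio]
          omega
        · intro p hp p' hp' h
          simp only at h
          rcases lt_trichotomy p.2 p'.2 with hlt | heq | hlt
          · have h7 : (p.1 : ℕ) ≤ p'.1 := key p hp p' hp' hlt
            have : (p.2 : ℕ) < p'.2 := hlt
            omega
          · have h8 : (p.2 : ℕ) = p'.2 := congrArg _ heq
            exact Prod.ext (Fin.ext (by omega)) heq
          · have h7 : (p'.1 : ℕ) ≤ p.1 := key p' hp' p hp hlt
            have : (p'.2 : ℕ) < p.2 := hlt
            omega
      rw [Finset.card_range] at h5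
      have h6 : (I.card : ℝ) ≤ n₀ + r := by
        have : I.card ≤ n₀ + r := by omega
        exact_mod_cast this
      have h7 : (1 / r) * ∑ j, ∑ i, tsirelsonNorm (restrictTo (A.E j) (y i)) ≤
          (1 / r : ℝ) * (n₀ + r) :=
        mul_le_mul_of_nonneg_left (h4.trans h6) (by positivity)
      have h8 : (1 / r : ℝ) * (n₀ + r) = 2 * (n₀ / (2 * r)) + 1 := by field_simp
      linarith

/-- The value at `x` of the functional with coefficients `c`. -/
noncomputable def finsuppPairing (c : ℕ → ℝ) : (ℕ →₀ ℝ) →ₗ[ℝ] ℝ :=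
  Finsupp.lsum ℝ fun i => (c i) • (LinearMap.id : ℝ →ₗ[ℝ] ℝ)

theorem finsuppPairing_apply (c : ℕ → ℝ) (x : ℕ →₀ ℝ) :
    finsuppPairing c x = ∑ i ∈ x.support, c i * x i := by
  simp [finsuppPairing, Finsupp.sum]

theorem finsuppPairing_eq_sum (c : ℕ → ℝ) (x : ℕ →₀ ℝ) (s : Finset ℕ) (h : x.support ⊆ s) :
    finsuppPairing c x = ∑ i ∈ s, c i * x i := by
  rw [finsuppPairing_apply]
  refine Finset.sum_subset h fun i _ hi => ?_
  rw [Finsupp.notMem_support_iff.1 hi, mul_zero]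

theorem Finsupp.exists_bound_support (x : ℕ →₀ ℝ) (n : ℕ) :
    ∃ m, n < m ∧ ∀ a, x a ≠ 0 → a < m := by
  refine ⟨n + x.support.sup id + 1, by omega, fun a ha => ?_⟩
  have : id a ≤ x.support.sup id := Finset.le_sup (Finsupp.mem_support_iff.2 ha)
  simp only [id] at this
  omega

/-- Choose a vector beyond the current bound, move the bound past its support, and iterate. -/
theorem exists_successive_blocks (Q : (ℕ →₀ ℝ) → Prop)
    (hQ : ∀ n, ∃ y, Q y ∧ ∀ a, y a ≠ 0 → n ≤ a) (r L : ℕ) :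
    ∃ (y : Fin r → ℕ →₀ ℝ) (ℓ : ℕ → ℕ), Monotone ℓ ∧ ℓ 0 = L ∧ (∀ i, Q (y i)) ∧
      ∀ (i : Fin r) a, y i a ≠ 0 → ℓ i ≤ a ∧ a < ℓ (i + 1) := by
  choose y hy1 hy2 using hQ
  choose m hm1 hm2 using fun n => Finsupp.exists_bound_support (y n) n
  have hstep : ∀ i, m^[i + 1] L = m (m^[i] L) := fun i => Function.iterate_succ_apply' m i L
  refine ⟨fun i => y (m^[(i : ℕ)] L), fun i => m^[i] L, ?_, rfl, fun i => hy1 _, ?_⟩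
  · refine monotone_nat_of_le_succ fun i => ?_
    rw [hstep]
    exact (hm1 _).le
  · intro i a ha
    refine ⟨hy2 _ a ha, ?_⟩
    show a < m^[(i : ℕ) + 1] L
    rw [hstep]
    exact hm2 _ a ha

/-- The unit vector basis of `T` is shrinking. -/
theorem tsirelson_shrinking (c : ℕ → ℝ) (C : ℝ)
    (hC : ∀ x, |finsuppPairing c x| ≤ C * tsirelsonNorm x) (ε : ℝ) (hε : 0 < ε) :
    ∃ n, ∀ x : ℕ →₀ ℝ, (∀ a, a < n → x a = 0) →
      |finsuppPairing c x| ≤ ε * tsirelsonNorm x := by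
  by_contra hcon
  push Not at hcon
  -- If the tails do not become small, each convex set `K n` contains vectors of norm at most `1 /
  -- ε`. The minimal norms on these sets increase with `n` to a limit `Θ`. Near the limit, convexity
  -- conflicts with the averaging estimate.
  let K : ℕ → Set (ℕ →₀ ℝ) := fun n => {x | (∀ a, a < n → x a = 0) ∧ 1 ≤ finsuppPairing c x}
  have hKmono : ∀ {n m}, n ≤ m → K m ⊆ K n := fun hnm x hx =>
    ⟨fun a ha => hx.1 a (lt_of_lt_of_le ha hnm), hx.2⟩
  have hKconv : ∀ n, Convex ℝ (K n) := by
    intro n x hx y hy s t hs ht hst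
    refine ⟨fun a ha => by simp [hx.1 a ha, hy.1 a ha], ?_⟩
    rw [map_add, map_smul, map_smul, smul_eq_mul, smul_eq_mul]
    nlinarith [hx.2, hy.2]
  have hKne : ∀ n, ∃ x ∈ K n, tsirelsonNorm x ≤ 1 / ε := by
    intro n
    obtain ⟨x, hx, hlt⟩ := hcon n
    set t := finsuppPairing c x with ht
    have ht0 : 0 < |t| :=
      lt_of_le_of_lt (mul_nonneg hε.le (tsirelsonNorm_nonneg x)) hlt
    refine ⟨t⁻¹ • x, ⟨fun a ha => by simp [hx a ha], ?_⟩, ?_⟩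
    · rw [map_smul, smul_eq_mul, ← ht, inv_mul_cancel₀ (abs_pos.1 ht0)]
    · rw [tsirelsonNorm_smul, abs_inv, le_div_iff₀ hε, inv_mul_eq_div, div_mul_eq_mul_div,
        div_le_one ht0]
      linarith
  have hClt : 0 < C := by
    obtain ⟨x, hx, _⟩ := hKne 0
    have h1 := (le_abs_self _).trans (hC x)
    have h2 := hx.2
    have h3 := tsirelsonNorm_nonneg x
    by_contra h
    push Not at h
    nlinarith
  have hKlow : ∀ n, ∀ x ∈ K n, 1 / C ≤ tsirelsonNorm x := by
    intro n x hx
    rw [div_le_iff₀ hClt]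
    have := (le_abs_self _).trans (hC x)
    linarith [hx.2]
  let θ : ℕ → ℝ := fun n => sInf (tsirelsonNorm '' K n)
  have hbdd : ∀ n, BddBelow (tsirelsonNorm '' K n) := fun n =>
    ⟨0, by rintro _ ⟨x, _, rfl⟩; exact tsirelsonNorm_nonneg x⟩
  have hne : ∀ n, (tsirelsonNorm '' K n).Nonempty := fun n => by
    obtain ⟨x, hx, _⟩ := hKne n
    exact ⟨_, x, hx, rfl⟩
  have hθle : ∀ n, ∀ x ∈ K n, θ n ≤ tsirelsonNorm x := fun n x hx =>
    csInf_le (hbdd n) ⟨x, hx, rfl⟩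
  have hθb : BddAbove (Set.range θ) := by
    refine ⟨1 / ε, ?_⟩
    rintro _ ⟨n, rfl⟩
    obtain ⟨x, hx, hx'⟩ := hKne n
    exact (hθle n x hx).trans hx'
  set Θ : ℝ := ⨆ n, θ n with hΘ
  have hΘpos : 0 < Θ := by
    have h1 : 1 / C ≤ θ 0 := le_csInf (hne 0) (by rintro _ ⟨x, hx, rfl⟩; exact hKlow 0 x hx)
    have h2 := le_ciSup hθb 0
    have h3 : 0 < 1 / C := by positivity
    linarith
  obtain ⟨n, hn⟩ : ∃ n, 19 / 20 * Θ < θ n := exists_lt_of_lt_ciSup (by linarith)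
  have hex : ∀ m, ∃ y ∈ K m, tsirelsonNorm y < 21 / 20 * Θ := by
    intro m
    have h1 : θ m < 21 / 20 * Θ := by
      have := le_ciSup hθb m
      linarith
    obtain ⟨_, ⟨y, hy, rfl⟩, hlt⟩ := exists_lt_of_csInf_lt (hne m) h1
    exact ⟨y, hy, hlt⟩
  obtain ⟨y₀, hy₀, hy₀lt⟩ := hex n
  obtain ⟨n₀, hn₀, hn₀'⟩ := Finsupp.exists_bound_support y₀ n
  -- With this many blocks the error `n₀ / (2 * r)` is `1 / 20`. The midpoint of `y₀` and the
  -- average then has norm at most `½ · (21/20) · (31/20) · Θ`, below the lower bound `(19/20) · Θ`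
  -- valid on `K n`.
  set r : ℕ := 10 * n₀ with hr
  have hrpos : 0 < r := by omega
  have hrR : (r : ℝ) = 10 * n₀ := by rw [hr]; push_cast; ring
  have hn₀R : (0 : ℝ) < n₀ := by exact_mod_cast (by omega : 0 < n₀)
  obtain ⟨y, ℓ, hℓ, hℓ0, hyQ, hyb⟩ := exists_successive_blocks
    (fun y => 1 ≤ finsuppPairing c y ∧ tsirelsonNorm y < 21 / 20 * Θ)
    (fun m => by
      obtain ⟨y, hy, hlt⟩ := hex m
      exact ⟨y, ⟨hy.2, hlt⟩, fun a ha => by by_contra h; exact ha (hy.1 a (by omega))⟩) r n₀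
  set w : ℕ →₀ ℝ := (1 / r : ℝ) • ∑ i, y i with hw
  have hwK : w ∈ K n := by
    refine ⟨fun a ha => ?_, ?_⟩
    · have : ∀ i, y i a = 0 := fun i => by
        by_contra h
        have h1 := (hyb i a h).1
        have h2 := hℓ (Nat.zero_le i.1)
        omega
      simp [hw, this]
    · rw [hw, map_smul, map_sum, smul_eq_mul]
      have : (r : ℝ) ≤ ∑ i, finsuppPairing c (y i) := by
        calc (r : ℝ) = ∑ _i : Fin r, (1 : ℝ) := by simp
          _ ≤ _ := Finset.sum_le_sum fun i _ => (hyQ i).1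
      have hrp : (0 : ℝ) < r := by exact_mod_cast hrpos
      rw [one_div_mul_eq_div, le_div_iff₀ hrp]
      linarith
  set κ : ℝ := 21 / 20 * Θ with hκ
  have hκpos : 0 < κ := by positivity
  have hscale : ∀ z, tsirelsonNorm z < κ → tsirelsonNorm (κ⁻¹ • z) ≤ 1 := by
    intro z hz
    rw [tsirelsonNorm_smul, abs_of_pos (by positivity), inv_mul_eq_div, div_le_one hκpos]
    exact hz.le
  have hFJ := tsirelsonNorm_add_average_le n₀ r hrpos (κ⁻¹ • y₀) (fun i => κ⁻¹ • y i) ℓ hℓ hℓ0.ge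
    (fun a ha => by
      by_contra h
      have : y₀ a ≠ 0 := fun h0 => h (by simp [h0])
      have := hn₀' a this
      omega)
    (fun i a ha => hyb i a fun h0 => ha (by simp [h0]))
    (hscale _ hy₀lt) (fun i => hscale _ (hyQ i).2)
  have hcomb : κ⁻¹ • y₀ + (1 / r : ℝ) • ∑ i, κ⁻¹ • y i = κ⁻¹ • (y₀ + w) := by
    rw [hw, ← Finset.smul_sum, smul_add, smul_comm]
  rw [hcomb, tsirelsonNorm_smul, abs_of_pos (by positivity), inv_mul_eq_div, div_le_iff₀ hκpos]
    at hFJ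
  have hmid := hθle n _ (hKconv n hy₀ hwK (by norm_num : (0 : ℝ) ≤ 1 / 2)
    (by norm_num : (0 : ℝ) ≤ 1 / 2) (by norm_num))
  rw [← smul_add, tsirelsonNorm_smul, abs_of_pos (by norm_num)] at hmid
  have hq : (n₀ : ℝ) / (2 * r) = 1 / 20 := by
    rw [hrR]
    field_simp
    norm_num
  rw [hq] at hFJ
  nlinarith

/-! ### Finite combinations of the unit vector basis of `T*` -/

/-- The finite combination `∑_{p ∈ P} c_p u_p` in `T*`. -/
noncomputable def dualComb (P : Finset ℕ) (c : ℕ → ℝ) : TsirelsonDual :=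
  ∑ p ∈ P, c p • tsirelsonDualBasis p

theorem dualComb_apply (P : Finset ℕ) (c : ℕ → ℝ) (x : SeminormedC00 tsirelsonSeminorm) :
    dualComb P c (x : TsirelsonSpace) = ∑ p ∈ P, c p * (show ℕ →₀ ℝ from x) p := by
  simp [dualComb, tsirelsonDualBasis_apply]

theorem abs_sum_le_dualComb (P : Finset ℕ) (c : ℕ → ℝ) (x : ℕ →₀ ℝ) :
    |∑ p ∈ P, c p * x p| ≤ ‖dualComb P c‖ * tsirelsonNorm x := by
  have h := (dualComb P c).le_opNorm ((show SeminormedC00 tsirelsonSeminorm from x) :)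
  rw [dualComb_apply, UniformSpace.Completion.norm_coe, SeminormedC00.norm_def] at h
  exact h

theorem TsirelsonDual.norm_le_of (φ : TsirelsonDual) (C : ℝ) (hC : 0 ≤ C)
    (h : ∀ x : SeminormedC00 tsirelsonSeminorm,
      |φ (x : TsirelsonSpace)| ≤ C * tsirelsonNorm (show ℕ →₀ ℝ from x)) : ‖φ‖ ≤ C := by
  refine ContinuousLinearMap.opNorm_le_bound _ hC fun x => ?_
  induction x using UniformSpace.Completion.induction_on with
  | hp => exact isClosed_le (by fun_prop) (by fun_prop)
  | ih x =>
    rw [UniformSpace.Completion.norm_coe, SeminormedC00.norm_def]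
    exact h x

theorem norm_dualComb_le (P : Finset ℕ) (c : ℕ → ℝ) (C : ℝ) (hC : 0 ≤ C)
    (h : ∀ x : ℕ →₀ ℝ, |∑ p ∈ P, c p * x p| ≤ C * tsirelsonNorm x) : ‖dualComb P c‖ ≤ C :=
  TsirelsonDual.norm_le_of _ C hC fun x => by
    rw [dualComb_apply]
    exact h _

/-- Dual to the fact that restriction to a set of coordinates is a contraction on `T`. -/
theorem norm_dualComb_mono {P Q : Finset ℕ} (h : P ⊆ Q) (c : ℕ → ℝ) :
    ‖dualComb P c‖ ≤ ‖dualComb Q c‖ := by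
  refine norm_dualComb_le _ _ _ (norm_nonneg _) fun x => ?_
  have h1 := abs_sum_le_dualComb Q c (restrictTo P x)
  have h2 : ∑ p ∈ Q, c p * restrictTo P x p = ∑ p ∈ P, c p * x p := by
    symm
    refine (Finset.sum_congr rfl fun p hp => ?_).trans
      (Finset.sum_subset (f := fun p => c p * restrictTo P x p) h fun p _ hp => ?_)
    · rw [restrictTo_apply, if_pos hp]
    · simp [restrictTo_apply, hp]
  rw [h2] at h1
  exact h1.trans (mul_le_mul_of_nonneg_left (tsirelsonNorm_restrictTo_le _ _) (norm_nonneg _))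

theorem norm_tsirelsonDualBasis (p : ℕ) : ‖tsirelsonDualBasis p‖ = 1 := by
  have h : tsirelsonDualBasis p = dualComb {p} fun _ => 1 := by simp [dualComb]
  rw [h]
  apply le_antisymm
  · refine norm_dualComb_le _ _ _ zero_le_one fun x => ?_
    simpa using abs_apply_le_tsirelsonNorm x p
  · have := abs_sum_le_dualComb {p} (fun _ => 1) (Finsupp.single p 1)
    simpa [tsirelsonNorm_single] using this

theorem norm_dualComb_singleton (p : ℕ) (c : ℕ → ℝ) : ‖dualComb {p} c‖ = |c p| := by
  simp [dualComb, norm_smul, norm_tsirelsonDualBasis]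

theorem dualComb_union {P Q : Finset ℕ} (h : Disjoint P Q) (c : ℕ → ℝ) :
    dualComb (P ∪ Q) c = dualComb P c + dualComb Q c := Finset.sum_union h

theorem dualComb_congr {P : Finset ℕ} {c d : ℕ → ℝ} (h : ∀ p ∈ P, c p = d p) :
    dualComb P c = dualComb P d :=
  Finset.sum_congr rfl fun p hp => by rw [h p hp]

theorem dualComb_biUnion {k : ℕ} (P : Fin k → Finset ℕ)
    (hP : ∀ i j, i < j → ∀ a ∈ P i, ∀ b ∈ P j, a < b) (c : ℕ → ℝ) :
    dualComb (Finset.univ.biUnion P) c = ∑ i, dualComb (P i) c := by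
  refine Finset.sum_biUnion fun i _ j _ hij => ?_
  rw [Function.onFun, Finset.disjoint_left]
  intro a hi hj
  rcases lt_or_gt_of_ne hij with h | h
  · exact lt_irrefl _ (hP i j h a hi a hj)
  · exact lt_irrefl _ (hP j i h a hj a hi)

/-- Sums of `k` successive blocks of `T*` beyond `k` are of the order of the largest one. -/
theorem norm_dualComb_biUnion_le {k : ℕ} (P : Fin k → Finset ℕ)
    (hP : ∀ i j, i < j → ∀ a ∈ P i, ∀ b ∈ P j, a < b) (hk : ∀ i, ∀ a ∈ P i, k ≤ a)
    (c : ℕ → ℝ) (B : ℝ) (hB : 0 ≤ B) (h : ∀ i, ‖dualComb (P i) c‖ ≤ B) :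
    ‖dualComb (Finset.univ.biUnion P) c‖ ≤ 2 * B := by
  rw [dualComb_biUnion P hP]
  refine TsirelsonDual.norm_le_of _ _ (by positivity) fun x => ?_
  let A : AdmissibleFamily := ⟨k, P, hP, fun i a ha => (hk i a ha).trans (Nat.le_succ a)⟩
  have hA := A.sum_le (show ℕ →₀ ℝ from x)
  rw [sum_apply]
  calc _ ≤ ∑ i, |dualComb (P i) c (x : TsirelsonSpace)| := Finset.abs_sum_le_sum_abs _ _
    _ ≤ ∑ i, B * tsirelsonNorm (restrictTo (P i) (show ℕ →₀ ℝ from x)) := by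
      refine Finset.sum_le_sum fun i _ => ?_
      rw [dualComb_apply]
      have h1 := abs_sum_le_dualComb (P i) c (restrictTo (P i) (show ℕ →₀ ℝ from x))
      have h2 : ∑ p ∈ P i, c p * restrictTo (P i) (show ℕ →₀ ℝ from x) p =
          ∑ p ∈ P i, c p * (show ℕ →₀ ℝ from x) p :=
        Finset.sum_congr rfl fun p hp => by rw [restrictTo_apply, if_pos hp]
      rw [h2] at h1
      exact h1.trans (mul_le_mul_of_nonneg_right (h i) (tsirelsonNorm_nonneg _))
    _ = B * ∑ i, tsirelsonNorm (restrictTo (A.E i) (show ℕ →₀ ℝ from x)) := by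
      rw [Finset.mul_sum]
    _ ≤ _ := by
      have := mul_le_mul_of_nonneg_left hA hB
      linarith

/-! ### Interval chains indexed by their starting points -/

/-- The intervals `[p, q p]`, for `p ∈ P`, are nonempty and successive. -/
def IsChainOn (P : Finset ℕ) (q : ℕ → ℕ) : Prop :=
  (∀ p ∈ P, p ≤ q p) ∧ ∀ p ∈ P, ∀ p' ∈ P, p < p' → q p < p'

/-- The vector of `T*` obtained by summing `a` over the intervals `[p, q p]`, for `p ∈ P`. -/
noncomputable def chainComb (P : Finset ℕ) (q : ℕ → ℕ) (a : ℕ → ℝ) : TsirelsonDual :=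
  dualComb P fun p => ∑ j ∈ Finset.Icc p (q p), a j

theorem IsChainOn.mono {P Q : Finset ℕ} {q : ℕ → ℕ} (h : IsChainOn Q q) (hPQ : P ⊆ Q) :
    IsChainOn P q :=
  ⟨fun p hp => h.1 p (hPQ hp), fun p hp p' hp' => h.2 p (hPQ hp) p' (hPQ hp')⟩

theorem IsChainOn.min {P : Finset ℕ} {q : ℕ → ℕ} (h : IsChainOn P q) (m : ℕ)
    (hm : ∀ p ∈ P, p ≤ m) : IsChainOn P fun p => min (q p) m :=
  ⟨fun p hp => le_min (h.1 p hp) (hm p hp),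
    fun p hp p' hp' hlt => (min_le_left _ _).trans_lt (h.2 p hp p' hp' hlt)⟩

theorem isChainOn_singleton {p : ℕ} {q : ℕ → ℕ} (h : p ≤ q p) : IsChainOn {p} q := by
  refine ⟨fun p' hp' => ?_, fun p₁ h₁ p₂ h₂ hlt => ?_⟩
  · rw [Finset.mem_singleton.1 hp']
    exact h
  · rw [Finset.mem_singleton.1 h₁, Finset.mem_singleton.1 h₂] at hlt
    exact absurd hlt (lt_irrefl _)

theorem norm_chainComb_singleton (p : ℕ) (q : ℕ → ℕ) (a : ℕ → ℝ) :
    ‖chainComb {p} q a‖ = |∑ j ∈ Finset.Icc p (q p), a j| :=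
  norm_dualComb_singleton _ _

theorem IsChainOn.exists_intervalChain {P : Finset ℕ} {q : ℕ → ℕ} (h : IsChainOn P q) :
    ∃ s : IntervalChain, ∀ a : ℕ →₀ ℝ, s.vec tsirelsonDualBasis a = chainComb P q a := by
  have hmem : ∀ i, P.orderEmbOfFin rfl i ∈ P := fun i => Finset.orderEmbOfFin_mem P rfl i
  refine ⟨⟨P.card, P.orderEmbOfFin rfl, fun i => q (P.orderEmbOfFin rfl i),
    fun i => h.1 _ (hmem i), fun i j hij =>
      h.2 _ (hmem i) _ (hmem j) ((P.orderEmbOfFin rfl).strictMono hij)⟩, fun a => ?_⟩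
  rw [IntervalChain.vec, chainComb, dualComb]
  conv_rhs => rw [← Finset.map_orderEmbOfFin_univ P rfl, Finset.sum_map]
  rfl

theorem IntervalChain.exists_isChainOn (s : IntervalChain) :
    ∃ P q, IsChainOn P q ∧ ∀ a : ℕ →₀ ℝ, s.vec tsirelsonDualBasis a = chainComb P q a := by
  classical
  have hmono : StrictMono s.p := fun i j hij => (s.le i).trans_lt (s.lt i j hij)
  have hq : ∀ i, Function.extend s.p s.q 0 (s.p i) = s.q i := fun i =>
    hmono.injective.extend_apply _ _ i
  refine ⟨Finset.univ.image s.p, Function.extend s.p s.q 0, ⟨?_, ?_⟩, fun a => ?_⟩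
  · intro p hp
    obtain ⟨i, -, rfl⟩ := Finset.mem_image.1 hp
    rw [hq]
    exact s.le i
  · intro p hp p' hp' hlt
    obtain ⟨i, -, rfl⟩ := Finset.mem_image.1 hp
    obtain ⟨j, -, rfl⟩ := Finset.mem_image.1 hp'
    rw [hq]
    exact s.lt i j (hmono.lt_iff_lt.1 hlt)
  · rw [chainComb, dualComb, Finset.sum_image fun i _ j _ hij => hmono.injective hij]
    simp only [hq]
    rfl

theorem norm_chainComb_le_jamesNorm {P : Finset ℕ} {q : ℕ → ℕ} (h : IsChainOn P q) (a : ℕ →₀ ℝ) :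
    ‖chainComb P q a‖ ≤ jamesNorm tsirelsonDualBasis a := by
  obtain ⟨s, hs⟩ := h.exists_intervalChain
  rw [← hs]
  exact le_ciSup (bddAbove_james tsirelsonDualBasis a) s

theorem jamesNorm_le_of (a : ℕ →₀ ℝ) (C : ℝ)
    (h : ∀ P q, IsChainOn P q → ‖chainComb P q a‖ ≤ C) : jamesNorm tsirelsonDualBasis a ≤ C :=
  ciSup_le fun s => by
    obtain ⟨P, q, hP, hs⟩ := s.exists_isChainOn
    rw [hs]
    exact h P q hP

theorem abs_sum_Icc_le_jamesNorm (a : ℕ →₀ ℝ) (p q : ℕ) :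
    |∑ j ∈ Finset.Icc p q, a j| ≤ jamesNorm tsirelsonDualBasis a := by
  rcases le_or_gt p q with h | h
  · have := norm_chainComb_le_jamesNorm (isChainOn_singleton (q := fun _ => q) h) a
    rwa [norm_chainComb_singleton] at this
  · rw [Finset.Icc_eq_empty (by omega), Finset.sum_empty, abs_zero]
    exact apply_nonneg (jamesSeminorm tsirelsonDualBasis) a

/-- Used for intervals crossing a given boundary: the members of a chain are disjoint, so only one
can cross, and its contribution is a multiple of a single unit vector. -/
theorem norm_dualComb_le_of_subsingleton (P : Finset ℕ) (c : ℕ → ℝ) (B : ℝ) (hB : 0 ≤ B)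
    (hs : ∀ p ∈ P, ∀ p' ∈ P, c p ≠ 0 → c p' ≠ 0 → p = p') (hc : ∀ p ∈ P, |c p| ≤ B) :
    ‖dualComb P c‖ ≤ B := by
  by_cases h : ∃ p ∈ P, c p ≠ 0
  · obtain ⟨p, hp, hcp⟩ := h
    have : dualComb P c = c p • tsirelsonDualBasis p := by
      refine Finset.sum_eq_single p (fun p' hp' hne => ?_) fun h => absurd hp h
      by_cases h0 : c p' = 0
      · rw [h0, zero_smul]
      · exact absurd (hs p' hp' p hp h0 hcp) hne
    rw [this, norm_smul, norm_tsirelsonDualBasis, mul_one]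
    exact hc p hp
  · push Not at h
    have : dualComb P c = 0 := Finset.sum_eq_zero fun p hp => by rw [h p hp, zero_smul]
    rwa [this, norm_zero]

/-! ### The space `J[(u_i)]` as a space of sequences -/

namespace JamesTsirelson

/-- The inclusion of `c₀₀` in `J[(u_i)]`. -/
noncomputable def ofFinsupp : (ℕ →₀ ℝ) →ₗ[ℝ] JamesTsirelson where
  toFun a := ((show SeminormedC00 (jamesSeminorm tsirelsonDualBasis) from a :) : JamesTsirelson)
  map_add' a b := UniformSpace.Completion.coe_add
    (show SeminormedC00 (jamesSeminorm tsirelsonDualBasis) from a :) b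
  map_smul' c a := UniformSpace.Completion.coe_smul c
    (show SeminormedC00 (jamesSeminorm tsirelsonDualBasis) from a :)

theorem norm_ofFinsupp (a : ℕ →₀ ℝ) : ‖ofFinsupp a‖ = jamesNorm tsirelsonDualBasis a :=
  UniformSpace.Completion.norm_coe
    (show SeminormedC00 (jamesSeminorm tsirelsonDualBasis) from a :)

theorem induction {p : JamesTsirelson → Prop} (hp : IsClosed {x | p x})
    (h : ∀ a, p (ofFinsupp a)) (x : JamesTsirelson) : p x :=
  UniformSpace.Completion.induction_on x hp h

theorem exists_ofFinsupp_near (x : JamesTsirelson) (ε : ℝ) (hε : 0 < ε) :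
    ∃ a, ‖x - ofFinsupp a‖ < ε := by
  have h : DenseRange ofFinsupp := UniformSpace.Completion.denseRange_coe
    (α := SeminormedC00 (jamesSeminorm tsirelsonDualBasis))
  obtain ⟨a, ha⟩ := h.exists_dist_lt x hε
  exact ⟨a, by rwa [dist_eq_norm] at ha⟩

theorem exists_functional (φ : (ℕ →₀ ℝ) →ₗ[ℝ] ℝ)
    (hφ : ∀ a, |φ a| ≤ jamesNorm tsirelsonDualBasis a) :
    ∃ ψ : StrongDual ℝ JamesTsirelson, (∀ a, ψ (ofFinsupp a) = φ a) ∧ ∀ x, |ψ x| ≤ ‖x‖ := by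
  let φ' : SeminormedC00 (jamesSeminorm tsirelsonDualBasis) →L[ℝ] ℝ :=
    LinearMap.mkContinuous (E := SeminormedC00 (jamesSeminorm tsirelsonDualBasis)) φ 1
      (fun x => by rw [one_mul]; exact hφ x)
  have h : ∀ a, φ'.extend UniformSpace.Completion.toComplL (ofFinsupp a) = φ a := fun a =>
    ContinuousLinearMap.extend_eq φ' (e := UniformSpace.Completion.toComplL)
      UniformSpace.Completion.denseRange_coe (UniformSpace.Completion.isUniformInducing_coe _) a
  refine ⟨φ'.extend UniformSpace.Completion.toComplL, h, fun x => ?_⟩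
  induction x using induction with
  | hp => exact isClosed_le (by fun_prop) (by fun_prop)
  | h a =>
    rw [h, norm_ofFinsupp]
    exact hφ a

theorem abs_apply_le_jamesNorm (j : ℕ) (a : ℕ →₀ ℝ) :
    |Finsupp.lapply (R := ℝ) j a| ≤ jamesNorm tsirelsonDualBasis a := by
  simpa using abs_sum_Icc_le_jamesNorm a j j

theorem abs_sum_le_jamesNorm (a : ℕ →₀ ℝ) :
    |finsuppPairing (fun _ => 1) a| ≤ jamesNorm tsirelsonDualBasis a := by
  have h := abs_sum_Icc_le_jamesNorm a 0 (a.support.sup id)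
  rw [finsuppPairing_eq_sum _ a (Finset.Icc 0 (a.support.sup id))]
  · simpa using h
  · intro j hj
    exact Finset.mem_Icc.2 ⟨Nat.zero_le _, Finset.le_sup (f := id) hj⟩

/-- The `j`-th coordinate functional on `J[(u_i)]`. -/
noncomputable def coord (j : ℕ) : StrongDual ℝ JamesTsirelson :=
  (exists_functional (Finsupp.lapply j) (abs_apply_le_jamesNorm j)).choose

theorem coord_ofFinsupp (j : ℕ) (a : ℕ →₀ ℝ) : coord j (ofFinsupp a) = a j :=
  (exists_functional (Finsupp.lapply j) (abs_apply_le_jamesNorm j)).choose_spec.1 a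

/-- The functional on `J[(u_i)]` that sums all coordinates. -/
noncomputable def total : StrongDual ℝ JamesTsirelson :=
  (exists_functional _ abs_sum_le_jamesNorm).choose

theorem total_ofFinsupp (a : ℕ →₀ ℝ) : total (ofFinsupp a) = finsuppPairing (fun _ => 1) a :=
  (exists_functional _ abs_sum_le_jamesNorm).choose_spec.1 a

theorem abs_total_le (x : JamesTsirelson) : |total x| ≤ ‖x‖ :=
  (exists_functional _ abs_sum_le_jamesNorm).choose_spec.2 x

/-- The sequence of coordinates. -/
noncomputable def seq (x : JamesTsirelson) (j : ℕ) : ℝ := coord j x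

theorem seq_ofFinsupp (a : ℕ →₀ ℝ) : seq (ofFinsupp a) = a := funext fun j => coord_ofFinsupp j a

theorem seq_sub (x y : JamesTsirelson) : seq (x - y) = seq x - seq y :=
  funext fun j => map_sub (coord j) x y

end JamesTsirelson

theorem chainComb_sub (P : Finset ℕ) (q : ℕ → ℕ) (a b : ℕ → ℝ) :
    chainComb P q (a - b) = chainComb P q a - chainComb P q b := by
  rw [chainComb, chainComb, chainComb, dualComb, dualComb, dualComb, ← Finset.sum_sub_distrib]
  refine Finset.sum_congr rfl fun p _ => ?_
  simp only [Pi.sub_apply, Finset.sum_sub_distrib]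
  exact sub_smul (∑ j ∈ Finset.Icc p (q p), a j) (∑ j ∈ Finset.Icc p (q p), b j)
    (tsirelsonDualBasis p)

namespace JamesTsirelson

theorem norm_chainComb_seq_le {P : Finset ℕ} {q : ℕ → ℕ} (h : IsChainOn P q)
    (x : JamesTsirelson) : ‖chainComb P q (seq x)‖ ≤ ‖x‖ := by
  induction x using induction with
  | hp =>
    refine isClosed_le ?_ continuous_norm
    unfold chainComb dualComb seq
    fun_prop
  | h a =>
    rw [seq_ofFinsupp, norm_ofFinsupp]
    exact norm_chainComb_le_jamesNorm h a

/-- Approximation by finitely supported vectors carries the chain formula for the norm over to the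
completion. Hence elements of the completion are determined by their coordinates, and norms can be
computed from these. -/
theorem norm_le_of_chainComb (x : JamesTsirelson) (C : ℝ)
    (h : ∀ P q, IsChainOn P q → ‖chainComb P q (seq x)‖ ≤ C) : ‖x‖ ≤ C := by
  refine le_of_forall_pos_le_add fun ε hε => ?_
  obtain ⟨a, ha⟩ := exists_ofFinsupp_near x (ε / 2) (by positivity)
  have h1 : ‖ofFinsupp a‖ ≤ C + ε / 2 := by
    rw [norm_ofFinsupp]
    refine jamesNorm_le_of _ _ fun P q hP => ?_
    have h2 := norm_chainComb_seq_le hP (x - ofFinsupp a)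
    rw [seq_sub, seq_ofFinsupp, chainComb_sub] at h2
    have h3 := norm_sub_norm_le (chainComb P q a) (chainComb P q (seq x))
    rw [norm_sub_rev] at h3
    linarith [h P q hP]
  have h2 := norm_sub_norm_le x (ofFinsupp a)
  linarith

theorem ext_seq {x y : JamesTsirelson} (h : seq x = seq y) : x = y := by
  rw [← sub_eq_zero, ← norm_le_zero_iff]
  refine norm_le_of_chainComb _ _ fun P q _ => ?_
  rw [seq_sub, chainComb_sub, h, sub_self, norm_zero]

theorem abs_sum_Icc_le (x : JamesTsirelson) (p q : ℕ) :
    |∑ j ∈ Finset.Icc p q, seq x j| ≤ ‖x‖ := by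
  rcases le_or_gt p q with h | h
  · have := norm_chainComb_seq_le (isChainOn_singleton (q := fun _ => q) h) x
    rwa [norm_chainComb_singleton] at this
  · rw [Finset.Icc_eq_empty (by omega), Finset.sum_empty, abs_zero]
    exact norm_nonneg x

theorem abs_coord_le (x : JamesTsirelson) (j : ℕ) : |coord j x| ≤ ‖x‖ := by
  simpa [seq] using abs_sum_Icc_le x j j

end JamesTsirelson

/-! ### Bounded completeness of the basis of `J[(u_i)]` -/

/-- If all chains give uniformly bounded vectors, then late chains give small vectors. -/
theorem exists_norm_chainComb_tail_le (a : ℕ → ℝ) (C : ℝ)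
    (hC : ∀ P q, IsChainOn P q → ‖chainComb P q a‖ ≤ C) (ε : ℝ) (hε : 0 < ε) :
    ∃ N, ∀ P q, IsChainOn P q → (∀ p ∈ P, N ≤ p) → ‖chainComb P q a‖ ≤ ε := by
  classical
  by_contra hcon
  push Not at hcon
  choose P q hch hN hlt using hcon
  have hbd : ∀ N, ∃ M, N < M ∧ ∀ p ∈ P N, q N p < M := by
    intro N
    refine ⟨N + (P N).sup (q N) + 1, by omega, fun p hp => ?_⟩
    have := Finset.le_sup (f := q N) hp
    omega
  choose M hM1 hM2 using hbd
  -- Each offending chain `P (ℓ i)` ends before the next one starts, so together they form one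
  -- infinite chain. Its interval sums define a functional on `T` that is bounded, since every
  -- finite part is a chain. Shrinking makes its tails small, contrary to the choice of the chains.
  set ℓ : ℕ → ℕ := fun i => M^[i] 0 with hℓ
  have hstep : ∀ i, ℓ (i + 1) = M (ℓ i) := fun i => Function.iterate_succ_apply' M i 0
  have hmono : StrictMono ℓ := strictMono_nat_of_lt_succ fun i => by rw [hstep]; exact hM1 _
  have hloc : ∀ i, ∀ p ∈ P (ℓ i), ℓ i ≤ p ∧ q (ℓ i) p < ℓ (i + 1) := fun i p hp =>
    ⟨hN _ p hp, by rw [hstep]; exact hM2 _ p hp⟩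
  have huniq : ∀ i j p, p ∈ P (ℓ i) → p ∈ P (ℓ j) → ¬ i < j := by
    intro i j p hi hj hij
    have h1 := (hloc i p hi).2
    have h2 := (hch (ℓ i)).1 p hi
    have h3 := (hloc j p hj).1
    have h4 : ℓ (i + 1) ≤ ℓ j := hmono.monotone hij
    omega
  let q' : ℕ → ℕ := fun p => if h : ∃ i, p ∈ P (ℓ i) then q (ℓ h.choose) p else 0
  have hq' : ∀ i, ∀ p ∈ P (ℓ i), q' p = q (ℓ i) p := by
    intro i p hp
    have h : ∃ i, p ∈ P (ℓ i) := ⟨i, hp⟩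
    have heq : h.choose = i := by
      rcases lt_trichotomy h.choose i with hlt | heq | hlt
      · exact absurd hlt (huniq _ _ p h.choose_spec hp)
      · exact heq
      · exact absurd hlt (huniq _ _ p hp h.choose_spec)
    simp only [q', dif_pos h, heq]
  let c : ℕ → ℝ := fun p => if ∃ i, p ∈ P (ℓ i) then ∑ j ∈ Finset.Icc p (q' p), a j else 0
  have hcC : ∀ x, |finsuppPairing c x| ≤ C * tsirelsonNorm x := by
    intro x
    set S := x.support.filter fun p => ∃ i, p ∈ P (ℓ i) with hS
    have hSch : IsChainOn S q' := by
      refine ⟨fun p hp => ?_, fun p hp p' hp' hlt => ?_⟩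
      · obtain ⟨i, hi⟩ := (Finset.mem_filter.1 hp).2
        rw [hq' i p hi]
        exact (hch _).1 p hi
      · obtain ⟨i, hi⟩ := (Finset.mem_filter.1 hp).2
        obtain ⟨j, hj⟩ := (Finset.mem_filter.1 hp').2
        rw [hq' i p hi]
        rcases lt_trichotomy i j with h | h | h
        · have h1 := (hloc i p hi).2
          have h2 := (hloc j p' hj).1
          have h4 : ℓ (i + 1) ≤ ℓ j := hmono.monotone h
          omega
        · subst h
          exact (hch _).2 p hi p' hj hlt
        · have h1 := (hloc j p' hj).2
          have h2 := (hch (ℓ j)).1 p' hj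
          have h3 := (hloc i p hi).1
          have h4 : ℓ (j + 1) ≤ ℓ i := hmono.monotone h
          omega
    have h1 : finsuppPairing c x = ∑ p ∈ S, (∑ j ∈ Finset.Icc p (q' p), a j) * x p := by
      rw [finsuppPairing_apply, hS, Finset.sum_filter]
      refine Finset.sum_congr rfl fun p _ => ?_
      simp only [c]
      split_ifs <;> simp
    rw [h1]
    exact (abs_sum_le_dualComb S _ x).trans
      (mul_le_mul_of_nonneg_right (hC S q' hSch) (tsirelsonNorm_nonneg x))
  obtain ⟨n, hn⟩ := tsirelson_shrinking c C hcC ε hε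
  have hcn : chainComb (P (ℓ n)) (q (ℓ n)) a = dualComb (P (ℓ n)) c := by
    refine dualComb_congr fun p hp => ?_
    simp only [c]
    rw [if_pos ⟨n, hp⟩, hq' n p hp]
  refine absurd (hlt (ℓ n)) (not_lt.2 ?_)
  rw [hcn]
  refine norm_dualComb_le _ _ _ hε.le fun x => ?_
  have h1 := hn (restrictTo (P (ℓ n)) x) fun b hb => by
    rw [restrictTo_apply, if_neg]
    intro hbP
    have h2 := (hloc n b hbP).1
    have h3 : n ≤ ℓ n := hmono.le_apply
    omega
  rw [finsuppPairing_eq_sum c _ (P (ℓ n)) fun b hb => by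
    by_contra h
    exact (Finsupp.mem_support_iff.1 hb) (by rw [restrictTo_apply, if_neg h])] at h1
  rw [Finset.sum_congr rfl fun p hp => by rw [restrictTo_apply, if_pos hp]] at h1
  exact h1.trans (mul_le_mul_of_nonneg_left (tsirelsonNorm_restrictTo_le _ _) hε.le)

/-- The sequence `a` cut down to the coordinates in `[m, n)`. -/
noncomputable def cutoff (m n : ℕ) (a : ℕ → ℝ) : ℕ →₀ ℝ :=
  Finsupp.indicator (Finset.Ico m n) fun i _ => a i

theorem cutoff_apply (m n : ℕ) (a : ℕ → ℝ) (j : ℕ) :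
    cutoff m n a j = if m ≤ j ∧ j < n then a j else 0 := by
  simp [cutoff, Finsupp.indicator_apply]

theorem sum_cutoff (m n : ℕ) (a : ℕ → ℝ) (s : Finset ℕ) :
    ∑ j ∈ s, cutoff m n a j = ∑ j ∈ s.filter (fun j => m ≤ j ∧ j < n), a j := by
  simp only [cutoff_apply, Finset.sum_filter]

/-- Cutting a chain to `[m, n)` changes the starting point of at most one interval, the one that
enters from the left of `m`. It costs one `ε`, and the intervals that start inside form a late chain
costing another. -/
theorem jamesNorm_cutoff_le (a : ℕ → ℝ) (ε : ℝ) (N : ℕ)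
    (hN : ∀ P q, IsChainOn P q → (∀ p ∈ P, N ≤ p) → ‖chainComb P q a‖ ≤ ε)
    (m n : ℕ) (hm : N ≤ m) : jamesNorm tsirelsonDualBasis (cutoff m n a) ≤ 2 * ε := by
  classical
  have hε : 0 ≤ ε := (norm_nonneg _).trans
    (hN ∅ id ⟨fun p hp => by simp at hp, fun p hp => by simp at hp⟩ fun p hp => by simp at hp)
  refine jamesNorm_le_of _ _ fun P q hP => ?_
  set c : ℕ → ℝ := fun p => ∑ j ∈ Finset.Icc p (q p), cutoff m n a j with hc
  set P₁ := P.filter (· < m) with hP₁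
  set P₂ := P.filter fun p => m ≤ p ∧ p < n with hP₂
  set P₃ := P.filter (fun p => m ≤ p ∧ n ≤ p) with hP₃
  have hone : ∀ q', |∑ j ∈ Finset.Icc m q', a j| ≤ ε := by
    intro q'
    rcases le_or_gt m q' with h | h
    · have := hN {m} (fun _ => q') (isChainOn_singleton h) fun p hp => by
        rw [Finset.mem_singleton.1 hp]; exact hm
      rwa [norm_chainComb_singleton] at this
    · rw [Finset.Icc_eq_empty (by omega), Finset.sum_empty, abs_zero]
      exact hε
  have h1 : ‖dualComb P₁ c‖ ≤ ε := by
    have hne : ∀ p ∈ P₁, c p ≠ 0 → m ≤ q p := by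
      intro p hp hcp
      by_contra h
      refine hcp (Finset.sum_eq_zero fun j hj => ?_)
      rw [Finset.mem_Icc] at hj
      rw [cutoff_apply, if_neg (by omega)]
    refine norm_dualComb_le_of_subsingleton _ _ _ hε (fun p hp p' hp' h h' => ?_) fun p hp => ?_
    · have hq := hne p hp h
      have hq' := hne p' hp' h'
      rw [hP₁, Finset.mem_filter] at hp hp'
      rcases lt_trichotomy p p' with hlt | heq | hlt
      · have := hP.2 p hp.1 p' hp'.1 hlt
        omega
      · exact heq
      · have := hP.2 p' hp'.1 p hp.1 hlt
        omega
    · rw [hP₁, Finset.mem_filter] at hp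
      simp only [hc, sum_cutoff]
      -- The right end `n - 1` is truncated subtraction, so the empty range `n = 0` is separated.
      rcases Nat.eq_zero_or_pos n with h0 | h0
      · subst h0
        simpa using hε
      · have : (Finset.Icc p (q p)).filter (fun j => m ≤ j ∧ j < n) =
            Finset.Icc m (min (q p) (n - 1)) := by
          ext j
          simp only [Finset.mem_filter, Finset.mem_Icc]
          omega
        rw [this]
        exact hone _
  have h2 : ‖dualComb P₂ c‖ ≤ ε := by
    have heq : dualComb P₂ c = chainComb P₂ (fun p => min (q p) (n - 1)) a := by
      refine dualComb_congr fun p hp => ?_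
      rw [hP₂, Finset.mem_filter] at hp
      simp only [hc, sum_cutoff]
      refine Finset.sum_congr ?_ fun _ _ => rfl
      ext j
      simp only [Finset.mem_filter, Finset.mem_Icc]
      omega
    rw [heq]
    refine hN _ _ ((hP.mono (Finset.filter_subset _ _)).min _ fun p hp => ?_) fun p hp => ?_
    · have := (Finset.mem_filter.1 hp).2
      omega
    · have := (Finset.mem_filter.1 hp).2
      omega
  have h3 : dualComb P₃ c = 0 := by
    refine Finset.sum_eq_zero fun p hp => ?_
    have hp' := (Finset.mem_filter.1 hp).2
    rw [show c p = 0 from Finset.sum_eq_zero fun j hj => ?_, zero_smul]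
    rw [Finset.mem_Icc] at hj
    rw [cutoff_apply, if_neg (by omega)]
  have hle : ‖dualComb P c‖ ≤ ‖dualComb P₁ c‖ + ‖dualComb P₂ c‖ + ‖dualComb P₃ c‖ := by
    have hsub : P ⊆ (P₁ ∪ P₂) ∪ P₃ := by
      intro p hp
      simp only [hP₁, hP₂, hP₃, Finset.mem_union, Finset.mem_filter, hp, true_and]
      omega
    refine (norm_dualComb_mono hsub c).trans ?_
    rw [dualComb_union, dualComb_union]
    · exact norm_add₃_le
    · rw [Finset.disjoint_left]
      intro p hp hp'
      simp only [hP₁, hP₂, Finset.mem_filter] at hp hp'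
      omega
    · rw [Finset.disjoint_left]
      intro p hp hp'
      simp only [hP₁, hP₂, hP₃, Finset.mem_union, Finset.mem_filter] at hp hp'
      omega
  rw [h3, norm_zero] at hle
  change ‖dualComb P c‖ ≤ 2 * ε
  linarith

theorem cutoff_zero_sub_cutoff_zero (a : ℕ → ℝ) {m n : ℕ} (h : m ≤ n) :
    cutoff 0 n a - cutoff 0 m a = cutoff m n a := by
  ext j
  simp only [Finsupp.sub_apply, cutoff_apply]
  split_ifs <;> first | omega | simp

theorem jamesNorm_single (j : ℕ) (t : ℝ) :
    jamesNorm tsirelsonDualBasis (Finsupp.single j t) ≤ |t| := by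
  classical
  refine jamesNorm_le_of _ _ fun P q hP => ?_
  have hsum : ∀ p, ∑ i ∈ Finset.Icc p (q p), Finsupp.single j t i =
      if j ∈ Finset.Icc p (q p) then t else 0 := by
    intro p
    simp only [Finsupp.single_apply]
    rw [Finset.sum_ite_eq]
  refine norm_dualComb_le_of_subsingleton _ _ _ (abs_nonneg t) (fun p hp p' hp' h h' => ?_)
    fun p hp => ?_
  · rw [hsum] at h h'
    have h1 : j ∈ Finset.Icc p (q p) := by by_contra h0; simp [h0] at h
    have h2 : j ∈ Finset.Icc p' (q p') := by by_contra h0; simp [h0] at h'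
    rw [Finset.mem_Icc] at h1 h2
    rcases lt_trichotomy p p' with hlt | heq | hlt
    · have := hP.2 p hp p' hp' hlt
      omega
    · exact heq
    · have := hP.2 p' hp' p hp hlt
      omega
  · rw [hsum]
    split_ifs
    · exact le_rfl
    · simp

namespace JamesTsirelson

/-- The unit vector basis of `J[(u_i)]` is boundedly complete. -/
theorem exists_seq_eq_of_bounded (a : ℕ → ℝ) (C : ℝ)
    (hC : ∀ P q, IsChainOn P q → ‖chainComb P q a‖ ≤ C) :
    ∃ x : JamesTsirelson, seq x = a ∧
      Tendsto (fun n => ofFinsupp (cutoff 0 n a)) atTop (𝓝 x) := by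
  have hcauchy : CauchySeq fun n => ofFinsupp (cutoff 0 n a) := by
    refine Metric.cauchySeq_iff'.2 fun ε hε => ?_
    obtain ⟨N, hN⟩ := exists_norm_chainComb_tail_le a C hC (ε / 4) (by positivity)
    refine ⟨N, fun n hn => ?_⟩
    rw [dist_eq_norm, ← map_sub, cutoff_zero_sub_cutoff_zero a hn, norm_ofFinsupp]
    have := jamesNorm_cutoff_le a _ N hN N n le_rfl
    linarith
  obtain ⟨x, hx⟩ := cauchySeq_tendsto_of_complete hcauchy
  refine ⟨x, funext fun j => ?_, hx⟩
  have h1 : Tendsto (fun n => coord j (ofFinsupp (cutoff 0 n a))) atTop (𝓝 (coord j x)) :=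
    ((coord j).continuous.tendsto x).comp hx
  refine tendsto_nhds_unique h1 (tendsto_const_nhds.congr' ?_)
  filter_upwards [eventually_gt_atTop j] with n hn
  rw [coord_ofFinsupp, cutoff_apply, if_pos ⟨Nat.zero_le j, hn⟩]

theorem tendsto_cutoff (x : JamesTsirelson) :
    Tendsto (fun n => ofFinsupp (cutoff 0 n (seq x))) atTop (𝓝 x) := by
  obtain ⟨y, hy, ht⟩ := exists_seq_eq_of_bounded (seq x) ‖x‖ fun P q hP =>
    norm_chainComb_seq_le hP x
  rwa [ext_seq hy] at ht

/-! ### Coordinatewise limits of bounded families -/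

/-- Coordinatewise convergence along a filter. -/
def CoordTendsto {ι : Type*} (z : ι → JamesTsirelson) (U : Filter ι) (x : JamesTsirelson) : Prop :=
  ∀ j, Tendsto (fun m => seq (z m) j) U (𝓝 (seq x j))

theorem tendsto_chainComb {ι : Type*} {z : ι → ℕ → ℝ} {U : Filter ι} {a : ℕ → ℝ}
    (h : ∀ j, Tendsto (fun m => z m j) U (𝓝 (a j))) (P : Finset ℕ) (q : ℕ → ℕ) :
    Tendsto (fun m => chainComb P q (z m)) U (𝓝 (chainComb P q a)) :=
  tendsto_finsetSum _ fun _ _ => (tendsto_finsetSum _ fun j _ => h j).smul_const _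

/-- Lower semicontinuity of the norm: each chain involves only finitely many coordinates. -/
theorem CoordTendsto.norm_le {ι : Type*} {z : ι → JamesTsirelson} {U : Filter ι} [U.NeBot]
    {x : JamesTsirelson} (h : CoordTendsto z U x) (C : ℝ) (hC : ∀ᶠ m in U, ‖z m‖ ≤ C) :
    ‖x‖ ≤ C := by
  refine norm_le_of_chainComb x C fun P q hP => ?_
  refine le_of_tendsto (tendsto_chainComb h P q).norm ?_
  filter_upwards [hC] with m hm
  exact (norm_chainComb_seq_le hP _).trans hm

end JamesTsirelson

theorem Ultrafilter.exists_tendsto_of_bounded {ι : Type*} (U : Ultrafilter ι) (t : ι → ℝ) (C : ℝ)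
    (h : ∀ m, |t m| ≤ C) : ∃ l, Tendsto t U (𝓝 l) := by
  obtain ⟨l, -, hl⟩ := (isCompact_Icc (a := -C) (b := C)).ultrafilter_le_nhds (U.map t)
    (by
      rw [le_principal_iff]
      exact Filter.mem_map.2 (Filter.univ_mem' fun m => abs_le.1 (h m)))
  exact ⟨l, hl⟩

namespace JamesTsirelson

/-- The limits of the coordinates satisfy the same chain bounds, so bounded completeness realizes
them by a vector. -/
theorem exists_coordTendsto {ι : Type*} (U : Ultrafilter ι) (z : ι → JamesTsirelson) (C : ℝ)
    (h : ∀ m, ‖z m‖ ≤ C) : ∃ x, CoordTendsto z U x := by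
  choose a ha using fun j => U.exists_tendsto_of_bounded (fun m => seq (z m) j) C
    fun m => (abs_coord_le (z m) j).trans (h m)
  obtain ⟨x, hx, -⟩ := exists_seq_eq_of_bounded a C fun P q hP =>
    le_of_tendsto' (tendsto_chainComb ha P q).norm fun m =>
      (norm_chainComb_seq_le hP _).trans (h m)
  exact ⟨x, fun j => by rw [hx]; exact ha j⟩

end JamesTsirelson

/-! ### Block sequences with vanishing sums -/

/-- `y` is a sequence of successive blocks beyond `L`, each with coordinates adding up to `0`. -/
def IsNullBlockSeq (L : ℕ) {k : ℕ} (y : Fin k → ℕ →₀ ℝ) : Prop :=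
  ∃ ℓ : ℕ → ℕ, Monotone ℓ ∧ ℓ 0 = L ∧
    ∀ i : Fin k, (∀ a, y i a ≠ 0 → ℓ i ≤ a ∧ a < ℓ (i + 1)) ∧
      finsuppPairing (fun _ => 1) (y i) = 0

theorem isNullBlockSeq_elim0 (L : ℕ) (y : Fin 0 → ℕ →₀ ℝ) : IsNullBlockSeq L y :=
  ⟨fun _ => L, monotone_const, rfl, fun i => i.elim0⟩

theorem IsNullBlockSeq.cons {L L' k : ℕ} {y₀ : ℕ →₀ ℝ} {y : Fin k → ℕ →₀ ℝ} (hL : L ≤ L')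
    (hy₀ : ∀ a, y₀ a ≠ 0 → L ≤ a ∧ a < L') (hs : finsuppPairing (fun _ => 1) y₀ = 0)
    (hy : IsNullBlockSeq L' y) : IsNullBlockSeq L (Fin.cons y₀ y : Fin (k + 1) → ℕ →₀ ℝ) := by
  obtain ⟨ℓ, hmono, h0, h⟩ := hy
  refine ⟨fun i => Nat.casesOn i L ℓ, ?_, rfl, fun i => ?_⟩
  · refine monotone_nat_of_le_succ fun i => ?_
    cases i with
    | zero => exact hL.trans h0.ge
    | succ i => exact hmono (Nat.le_succ i)
  · refine Fin.cases ?_ (fun i => ?_) i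
    · simp only [Fin.cons_zero]
      refine ⟨fun a ha => ?_, hs⟩
      have := hy₀ a ha
      exact ⟨this.1, this.2.trans_le h0.ge⟩
    · simp only [Fin.cons_succ]
      exact h i

theorem IsNullBlockSeq.smul {L k : ℕ} {y : Fin k → ℕ →₀ ℝ} (hy : IsNullBlockSeq L y)
    (t : Fin k → ℝ) : IsNullBlockSeq L fun i => t i • y i := by
  obtain ⟨ℓ, hmono, h0, h⟩ := hy
  refine ⟨ℓ, hmono, h0, fun i => ⟨fun a ha => (h i).1 a fun h0 => ha (by simp [h0]), ?_⟩⟩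
  rw [map_smul, (h i).2, smul_zero]

theorem abs_sum_le_of_subsingleton {k : ℕ} (g : Fin k → ℝ) (B : ℝ) (hB : 0 ≤ B)
    (hs : ∀ i j, g i ≠ 0 → g j ≠ 0 → i = j) (hg : ∀ i, |g i| ≤ B) : |∑ i, g i| ≤ B := by
  by_cases h : ∃ i, g i ≠ 0
  · obtain ⟨i, hi⟩ := h
    rw [Finset.sum_eq_single i (fun j _ hj => by_contra fun h0 => hj (hs j i h0 hi))
      fun h => absurd (Finset.mem_univ i) h]
    exact hg i
  · push Not at h
    rw [Finset.sum_eq_zero fun i _ => h i, abs_zero]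
    exact hB

/-- The asymptotic-`c₀` estimate for blocks in the kernel of the summing functional. -/
theorem jamesNorm_sum_nullBlocks_le {k L : ℕ} (hL : k ≤ L) (y : Fin k → ℕ →₀ ℝ)
    (hy : IsNullBlockSeq L y) (B : ℝ) (hB : 0 ≤ B)
    (hyB : ∀ i, jamesNorm tsirelsonDualBasis (y i) ≤ B) :
    jamesNorm tsirelsonDualBasis (∑ i, y i) ≤ 5 * B := by
  classical
  obtain ⟨ℓ, hmono, h0, hyℓ⟩ := hy
  have hlt : ∀ {i j : Fin k}, i < j → ℓ (i + 1) ≤ ℓ j := fun {i j} h => hmono h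
  have hzero : ∀ (i : Fin k) a, ¬ (ℓ i ≤ a ∧ a < ℓ (i + 1)) → y i a = 0 := fun i a h =>
    by_contra fun hne => h ((hyℓ i).1 a hne)
  have htot : ∀ (i : Fin k) (t q : ℕ), t ≤ ℓ i → ℓ (i + 1) ≤ q + 1 →
      ∑ j ∈ Finset.Icc t q, y i j = 0 := by
    intro i t q ht hq
    have h1 := (hyℓ i).2
    rw [finsuppPairing_eq_sum _ _ (Finset.Icc t q)] at h1
    · simpa using h1
    · intro a ha
      have := (hyℓ i).1 a (Finsupp.mem_support_iff.1 ha)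
      rw [Finset.mem_Icc]
      omega
  set Y : ℕ →₀ ℝ := ∑ i, y i with hY
  have hYapp : ∀ s : Finset ℕ, ∑ j ∈ s, Y j = ∑ i, ∑ j ∈ s, y i j := by
    intro s
    rw [Finset.sum_comm]
    exact Finset.sum_congr rfl fun j _ => by rw [hY, Finsupp.finsetSum_apply]
  -- An interval whose left end `t` cuts no block contains whole blocks, which sum to `0`, and at
  -- most one partial block, the one containing `q`.
  have hbdry : ∀ t q, (∀ i : Fin k, t ≤ ℓ i ∨ ℓ (i + 1) ≤ t) →
      |∑ j ∈ Finset.Icc t q, Y j| ≤ B := by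
    intro t q ht
    rw [hYapp]
    have hloc : ∀ i, ∑ j ∈ Finset.Icc t q, y i j ≠ 0 → ℓ i ≤ q ∧ q < ℓ (i + 1) := by
      intro i hi
      by_contra hcon
      refine hi ?_
      rcases ht i with h | h
      · rcases lt_or_ge q (ℓ i) with h' | h'
        · refine Finset.sum_eq_zero fun j hj => hzero i j ?_
          rw [Finset.mem_Icc] at hj
          omega
        · exact htot i t q h (by omega)
      · refine Finset.sum_eq_zero fun j hj => hzero i j ?_
        rw [Finset.mem_Icc] at hj
        omega
    refine abs_sum_le_of_subsingleton _ B hB (fun i j hi hj => ?_) fun i =>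
      (abs_sum_Icc_le_jamesNorm _ _ _).trans (hyB i)
    have h1 := hloc i hi
    have h2 := hloc j hj
    rcases lt_trichotomy i j with h | h | h
    · have := hlt h
      omega
    · exact h
    · have := hlt h
      omega
  have hbdry_succ : ∀ (i : Fin k) q, |∑ j ∈ Finset.Icc (ℓ (i + 1)) q, Y j| ≤ B := by
    intro i q
    refine hbdry _ _ fun i' => ?_
    rcases le_or_gt i' i with h | h
    · right
      have h' : (i' : ℕ) ≤ i := h
      exact hmono (by omega)
    · left
      exact hlt h
  refine jamesNorm_le_of _ _ fun P q hP => ?_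
  -- The intervals are sorted by starting point: before all blocks (cost `B`), inside block `i`
  -- (cost `2 * B` for each `i`, hence `4 * B` jointly by the `T*` estimate), and after all blocks
  -- (cost `0`).
  set c : ℕ → ℝ := fun p => ∑ j ∈ Finset.Icc p (q p), Y j with hc
  set P₀ := P.filter (· < ℓ 0) with hP₀
  set R : Fin k → Finset ℕ := fun i => P.filter fun p => ℓ i ≤ p ∧ p < ℓ (i + 1) with hR
  set P₂ := P.filter (ℓ k ≤ ·) with hP₂
  have h1 : ‖dualComb P₀ c‖ ≤ B := by
    have hne : ∀ p ∈ P₀, c p ≠ 0 → ℓ 0 ≤ q p := by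
      intro p hp hcp
      by_contra h
      refine hcp ?_
      simp only [hc]
      rw [hYapp]
      refine Finset.sum_eq_zero fun i _ => Finset.sum_eq_zero fun j hj => hzero i j ?_
      rw [Finset.mem_Icc] at hj
      have := hmono (Nat.zero_le i.1)
      omega
    refine norm_dualComb_le_of_subsingleton _ _ _ hB (fun p hp p' hp' h h' => ?_) fun p hp => ?_
    · have hq := hne p hp h
      have hq' := hne p' hp' h'
      rw [hP₀, Finset.mem_filter] at hp hp'
      rcases lt_trichotomy p p' with hlt | heq | hlt
      · have := hP.2 p hp.1 p' hp'.1 hlt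
        omega
      · exact heq
      · have := hP.2 p' hp'.1 p hp.1 hlt
        omega
    · rw [hP₀, Finset.mem_filter] at hp
      refine hbdry _ _ fun i => Or.inl (hp.2.le.trans (hmono (Nat.zero_le _)))
  have h2 : ∀ i, ‖dualComb (R i) c‖ ≤ 2 * B := by
    intro i
    set d : ℕ → ℝ := fun p => ∑ j ∈ Finset.Icc (ℓ (i + 1)) (q p), Y j with hd
    set q' : ℕ → ℕ := fun p => min (q p) (ℓ (i + 1) - 1) with hq'
    have hmemR : ∀ p ∈ R i, p ∈ P ∧ ℓ i ≤ p ∧ p < ℓ (i + 1) := fun p hp => Finset.mem_filter.1 hp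
    -- Each interval is split at the end of block `i`. The inner parts form a chain acting on `y i`
    -- alone. Only one interval can have a nonempty outer part, and that part begins at a block
    -- boundary.
    have hsplit : dualComb (R i) c = chainComb (R i) q' (y i) + dualComb (R i) d := by
      rw [chainComb, dualComb, dualComb, dualComb, ← Finset.sum_add_distrib]
      refine Finset.sum_congr rfl fun p hp => ?_
      obtain ⟨hpP, hp1, hp2⟩ := hmemR p hp
      have hpq := hP.1 p hpP
      have hq'p : q' p = min (q p) (ℓ (i + 1) - 1) := rfl
      have hYy : ∑ j ∈ Finset.Icc p (q' p), y i j = ∑ j ∈ Finset.Icc p (q' p), Y j := by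
        rw [hYapp]
        symm
        refine Finset.sum_eq_single i (fun i' _ hne => ?_) fun h => absurd (Finset.mem_univ i) h
        refine Finset.sum_eq_zero fun j hj => hzero i' j ?_
        rw [Finset.mem_Icc] at hj
        rcases lt_or_gt_of_ne hne with h | h
        · have := hlt h
          omega
        · have := hlt h
          omega
      have hcp : c p = ∑ j ∈ Finset.Icc p (q' p), y i j + d p := by
        rw [hYy]
        simp only [hc, hd]
        rw [← Finset.sum_union]
        · refine Finset.sum_congr ?_ fun _ _ => rfl
          ext j
          simp only [Finset.mem_union, Finset.mem_Icc]
          omega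
        · rw [Finset.disjoint_left]
          intro j hj hj'
          rw [Finset.mem_Icc] at hj hj'
          omega
      rw [hcp]
      exact add_smul (∑ j ∈ Finset.Icc p (q' p), y i j) (d p) (tsirelsonDualBasis p)
    have h3 : ‖chainComb (R i) q' (y i)‖ ≤ B :=
      (norm_chainComb_le_jamesNorm ((hP.mono (Finset.filter_subset _ _)).min _ fun p hp => by
        have := hmemR p hp
        omega) _).trans (hyB i)
    have h4 : ‖dualComb (R i) d‖ ≤ B := by
      refine norm_dualComb_le_of_subsingleton _ _ _ hB (fun p hp p' hp' h h' => ?_) fun p _ =>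
        hbdry_succ i _
      have hne : ∀ p, d p ≠ 0 → ℓ (i + 1) ≤ q p := fun p hdp => by
        by_contra h
        refine hdp ?_
        simp only [hd]
        rw [Finset.Icc_eq_empty h, Finset.sum_empty]
      have hq := hne p h
      have hq' := hne p' h'
      have hp1 := hmemR p hp
      have hp2 := hmemR p' hp'
      rcases lt_trichotomy p p' with hlt | heq | hlt
      · have := hP.2 p hp1.1 p' hp2.1 hlt
        omega
      · exact heq
      · have := hP.2 p' hp2.1 p hp1.1 hlt
        omega
    rw [hsplit]
    refine (norm_add_le _ _).trans ?_
    linarith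
  have hPall : ‖dualComb (Finset.univ.biUnion R) c‖ ≤ 2 * (2 * B) := by
    refine norm_dualComb_biUnion_le R (fun i j hij a ha b hb => ?_) (fun i a ha => ?_) c _
      (by positivity) h2
    · have h3 := (Finset.mem_filter.1 ha).2
      have h4 := (Finset.mem_filter.1 hb).2
      have := hlt hij
      omega
    · have h3 := (Finset.mem_filter.1 ha).2
      have := hmono (Nat.zero_le i.1)
      omega
  have h3 : dualComb P₂ c = 0 := by
    refine Finset.sum_eq_zero fun p hp => ?_
    have hp' := (Finset.mem_filter.1 hp).2
    have hcp : c p = 0 := by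
      simp only [hc]
      rw [hYapp]
      refine Finset.sum_eq_zero fun i _ => Finset.sum_eq_zero fun j hj => hzero i j ?_
      rw [Finset.mem_Icc] at hj
      have : ℓ (i + 1) ≤ ℓ k := hmono (by omega)
      omega
    rw [hcp, zero_smul]
  have hcover : ∀ n p, ℓ 0 ≤ p → p < ℓ n → ∃ i < n, ℓ i ≤ p ∧ p < ℓ (i + 1) := by
    intro n p hp0
    induction n with
    | zero => intro h; omega
    | succ n ih =>
      intro h
      rcases lt_or_ge p (ℓ n) with h' | h'
      · obtain ⟨i, hi, hi'⟩ := ih h'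
        exact ⟨i, by omega, hi'⟩
      · exact ⟨n, by omega, h', h⟩
  have hsub : P ⊆ (P₀ ∪ Finset.univ.biUnion R) ∪ P₂ := by
    intro p hp
    rw [Finset.mem_union, Finset.mem_union]
    rcases lt_or_ge p (ℓ 0) with h | h
    · exact Or.inl (Or.inl (Finset.mem_filter.2 ⟨hp, h⟩))
    · rcases lt_or_ge p (ℓ k) with h' | h'
      · obtain ⟨i, hi, hi'⟩ := hcover k p h h'
        exact Or.inl (Or.inr (Finset.mem_biUnion.2
          ⟨⟨i, hi⟩, Finset.mem_univ _, Finset.mem_filter.2 ⟨hp, hi'⟩⟩))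
      · exact Or.inr (Finset.mem_filter.2 ⟨hp, h'⟩)
  have hRmem : ∀ p ∈ Finset.univ.biUnion R, ℓ 0 ≤ p ∧ p < ℓ k := by
    intro p hp
    obtain ⟨i, -, hi⟩ := Finset.mem_biUnion.1 hp
    have h3 := (Finset.mem_filter.1 hi).2
    have h4 := hmono (Nat.zero_le i.1)
    have : ℓ (i + 1) ≤ ℓ k := hmono (by omega)
    omega
  have hle : ‖dualComb P c‖ ≤
      ‖dualComb P₀ c‖ + ‖dualComb (Finset.univ.biUnion R) c‖ + ‖dualComb P₂ c‖ := by
    refine (norm_dualComb_mono hsub c).trans ?_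
    rw [dualComb_union, dualComb_union]
    · exact norm_add₃_le
    · rw [Finset.disjoint_left]
      intro p hp hp'
      have h3 := (Finset.mem_filter.1 hp).2
      have h4 := hRmem p hp'
      omega
    · rw [Finset.disjoint_left]
      intro p hp hp'
      have h3 := (Finset.mem_filter.1 hp').2
      have hk : ℓ 0 ≤ ℓ k := hmono (Nat.zero_le k)
      rcases Finset.mem_union.1 hp with hp | hp
      · have h4 := (Finset.mem_filter.1 hp).2
        omega
      · have h4 := hRmem p hp
        omega
  rw [h3, norm_zero] at hle
  change ‖dualComb P c‖ ≤ 5 * B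
  linarith

/-! ### Approximation by null blocks -/

namespace JamesTsirelson

theorem norm_ofFinsupp_single (j : ℕ) (t : ℝ) : ‖ofFinsupp (Finsupp.single j t)‖ ≤ |t| := by
  rw [norm_ofFinsupp]
  exact jamesNorm_single j t

theorem norm_cutoff_zero_le (L : ℕ) (a : ℕ → ℝ) :
    ‖ofFinsupp (cutoff 0 L a)‖ ≤ ∑ j ∈ Finset.range L, |a j| := by
  have : cutoff 0 L a = ∑ j ∈ Finset.range L, Finsupp.single j (a j) := by
    ext i
    simp [cutoff_apply, Finsupp.finsetSum_apply, Finsupp.single_apply]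
  rw [this, map_sum]
  exact (norm_sum_le _ _).trans (Finset.sum_le_sum fun j _ => norm_ofFinsupp_single j _)

/-- A vector whose first coordinates and whose total sum nearly vanish is close to a block with
vanishing sum. -/
theorem exists_null_block_near (x : JamesTsirelson) (L : ℕ) (δ : ℝ) (hδ : 0 < δ)
    (hL : ∑ j ∈ Finset.range L, |seq x j| ≤ δ) (ht : |total x| ≤ δ) :
    ∃ (y : ℕ →₀ ℝ) (L' : ℕ), L ≤ L' ∧ (∀ a, y a ≠ 0 → L ≤ a ∧ a < L') ∧
      finsuppPairing (fun _ => 1) y = 0 ∧ ‖x - ofFinsupp y‖ ≤ 5 * δ := by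
  obtain ⟨L', hL', hnear⟩ : ∃ L', L < L' ∧ ‖x - ofFinsupp (cutoff 0 L' (seq x))‖ ≤ δ := by
    have h1 := (Metric.tendsto_atTop.1 (tendsto_cutoff x)) δ hδ
    obtain ⟨N, hN⟩ := h1
    -- Strictness `L < L'` leaves room for the correcting multiple of the unit vector at `L` inside
    -- `[L, L')`.
    refine ⟨max N (L + 1), by omega, ?_⟩
    have := hN (max N (L + 1)) (le_max_left _ _)
    rw [dist_eq_norm, norm_sub_rev] at this
    exact this.le
  set y' := cutoff L L' (seq x) with hy'
  have h1 : ‖x - ofFinsupp y'‖ ≤ 2 * δ := by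
    have h2 : x - ofFinsupp y' =
        (x - ofFinsupp (cutoff 0 L' (seq x))) + ofFinsupp (cutoff 0 L (seq x)) := by
      rw [hy', ← cutoff_zero_sub_cutoff_zero _ hL'.le, map_sub]
      abel
    rw [h2]
    refine (norm_add_le _ _).trans ?_
    have := (norm_cutoff_zero_le L (seq x)).trans hL
    linarith
  set t := finsuppPairing (fun _ => 1) y' with htdef
  have h2 : |t| ≤ 3 * δ := by
    have h3 := abs_total_le (x - ofFinsupp y')
    rw [map_sub, total_ofFinsupp, ← htdef] at h3
    have h4 := abs_sub_abs_le_abs_sub t (total x)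
    rw [abs_sub_comm] at h4
    linarith
  -- The error is `2 * δ` for the two cuts plus `|t| ≤ 3 * δ` for restoring the vanishing sum.
  refine ⟨y' - Finsupp.single L t, L', hL'.le, fun a ha => ?_, ?_, ?_⟩
  · by_contra hcon
    refine ha ?_
    rw [Finsupp.sub_apply, hy', cutoff_apply, if_neg hcon, Finsupp.single_apply,
      if_neg (by omega), sub_zero]
  · rw [map_sub, ← htdef, finsuppPairing_eq_sum _ (Finsupp.single L t) {L}
      Finsupp.support_single_subset]
    simp
  · rw [map_sub]
    have h3 : x - (ofFinsupp y' - ofFinsupp (Finsupp.single L t)) =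
        (x - ofFinsupp y') + ofFinsupp (Finsupp.single L t) := by abel
    rw [h3]
    refine (norm_add_le _ _).trans ?_
    have := (norm_ofFinsupp_single L t).trans h2
    linarith

theorem norm_sum_le_of_near_nullBlocks {k L : ℕ} (hL : k ≤ L) (x : Fin k → JamesTsirelson)
    (y : Fin k → ℕ →₀ ℝ) (hy : IsNullBlockSeq L y) (B δ : ℝ) (hδ : 0 ≤ δ)
    (hx : ∀ i, ‖x i‖ ≤ B) (hxy : ∀ i, ‖x i - ofFinsupp (y i)‖ ≤ δ) (hB : 0 ≤ B) :
    ‖∑ i, x i‖ ≤ 5 * (B + δ) + k * δ := by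
  have h1 : ‖ofFinsupp (∑ i, y i)‖ ≤ 5 * (B + δ) := by
    rw [norm_ofFinsupp]
    refine jamesNorm_sum_nullBlocks_le hL y hy _ (by positivity) fun i => ?_
    rw [← norm_ofFinsupp]
    have := norm_sub_norm_le (ofFinsupp (y i)) (x i)
    rw [norm_sub_rev] at this
    linarith [hx i, hxy i]
  have h2 : ∑ i, x i = ofFinsupp (∑ i, y i) + ∑ i, (x i - ofFinsupp (y i)) := by
    rw [map_sum, Finset.sum_sub_distrib]
    abel
  have h3 : ‖∑ i, (x i - ofFinsupp (y i))‖ ≤ k * δ := by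
    refine (norm_sum_le _ _).trans ((Finset.sum_le_sum fun i _ => hxy i).trans ?_)
    simp
  rw [h2]
  exact (norm_add_le _ _).trans (add_le_add h1 h3)

end JamesTsirelson

/-! ### The dual and the bidual of `J[(u_i)]` -/

namespace JamesTsirelson

/-- Otherwise there are `k` successive null blocks of norm at most `1` on which `φ` equals `ε`.
Their sum has norm at most `5`, while `φ` takes the value `k * ε` there, which is impossible for
large `k`. The blocks start at `k`, as the estimate for `k` blocks requires. -/
theorem exists_abs_functional_le_on_tail (φ : StrongDual ℝ JamesTsirelson) (ε : ℝ) (hε : 0 < ε) :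
    ∃ L, ∀ y : ℕ →₀ ℝ, (∀ a, y a ≠ 0 → L ≤ a) → finsuppPairing (fun _ => 1) y = 0 →
      |φ (ofFinsupp y)| ≤ ε * ‖ofFinsupp y‖ := by
  by_contra hcon
  push Not at hcon
  obtain ⟨k, hk⟩ := exists_nat_gt (‖φ‖ * 5 / ε)
  obtain ⟨y, ℓ, hmono, h0, hQ, hℓ⟩ := exists_successive_blocks
    (fun y => finsuppPairing (fun _ => 1) y = 0 ∧ ‖ofFinsupp y‖ ≤ 1 ∧ φ (ofFinsupp y) = ε)
    (fun L => by
      obtain ⟨y, hy, hs, hlt⟩ := hcon L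
      have hpos : 0 < |φ (ofFinsupp y)| :=
        lt_of_le_of_lt (mul_nonneg hε.le (norm_nonneg _)) hlt
      refine ⟨(ε / φ (ofFinsupp y)) • y, ⟨?_, ?_, ?_⟩, fun a ha => hy a fun h => ha (by simp [h])⟩
      · rw [map_smul, hs, smul_zero]
      · rw [map_smul, norm_smul, Real.norm_eq_abs, abs_div, abs_of_pos hε, div_mul_eq_mul_div,
          div_le_one hpos]
        exact hlt.le
      · rw [map_smul, map_smul, smul_eq_mul, div_mul_cancel₀ _ (abs_pos.1 hpos)]) k k
  have h1 := jamesNorm_sum_nullBlocks_le le_rfl y ⟨ℓ, hmono, h0, fun i => ⟨hℓ i, (hQ i).1⟩⟩ 1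
    zero_le_one fun i => by rw [← norm_ofFinsupp]; exact (hQ i).2.1
  rw [← norm_ofFinsupp] at h1
  have h2 : φ (ofFinsupp (∑ i, y i)) = k * ε := by
    rw [map_sum, map_sum, Finset.sum_congr rfl fun i _ => (hQ i).2.2]
    simp
  have h3 := (le_abs_self _).trans (φ.le_opNorm (ofFinsupp (∑ i, y i)))
  rw [h2] at h3
  rw [div_lt_iff₀ hε] at hk
  have h4 := mul_le_mul_of_nonneg_left h1 (norm_nonneg φ)
  linarith

theorem exists_functional_near (φ : StrongDual ℝ JamesTsirelson) (ε : ℝ) (hε : 0 < ε) :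
    ∃ (L : ℕ) (t : ℝ) (c : ℕ → ℝ),
      ‖φ - (t • total + ∑ j ∈ Finset.range L, c j • coord j)‖ ≤ ε := by
  obtain ⟨L, hL⟩ := exists_abs_functional_le_on_tail φ (ε / 6) (by positivity)
  set e : ℕ → JamesTsirelson := fun j => ofFinsupp (Finsupp.single j 1) with he
  -- The approximant agrees with `φ` on `e 0, …, e L` and equals `φ (e L)` on later unit vectors.
  -- The difference at `a` is therefore `φ` at a null vector `y` supported beyond `L`. Its norm is
  -- at most `6 * ‖a‖`, whence `ε / 6` above.
  refine ⟨L, φ (e L), fun j => φ (e j) - φ (e L), ?_⟩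
  refine ContinuousLinearMap.opNorm_le_bound _ hε.le fun x => ?_
  induction x using induction with
  | hp => exact isClosed_le (by fun_prop) (by fun_prop)
  | h a =>
    set b : ℕ →₀ ℝ := a - cutoff 0 L a with hb
    set s : ℝ := finsuppPairing (fun _ => 1) b with hs
    set y : ℕ →₀ ℝ := b - Finsupp.single L s with hy
    have hcut : cutoff 0 L a = ∑ j ∈ Finset.range L, Finsupp.single j (a j) := by
      ext i
      simp [cutoff_apply, Finsupp.finsetSum_apply, Finsupp.single_apply]
    have hpair : ∀ j t, finsuppPairing (fun _ => 1) (Finsupp.single j t) = t := by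
      intro j t
      rw [finsuppPairing_eq_sum _ _ {j} Finsupp.support_single_subset]
      simp
    have hbn : ‖ofFinsupp b‖ ≤ 3 * ‖ofFinsupp a‖ := by
      rw [hb, map_sub]
      refine (norm_sub_le _ _).trans ?_
      have h1 : ‖ofFinsupp (cutoff 0 L a)‖ ≤ 2 * ‖ofFinsupp a‖ := by
        rw [norm_ofFinsupp, norm_ofFinsupp]
        exact jamesNorm_cutoff_le a _ 0 (fun P q hP _ => norm_chainComb_le_jamesNorm hP a) 0 L
          le_rfl
      linarith
    have hsn : |s| ≤ ‖ofFinsupp b‖ := by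
      have := abs_total_le (ofFinsupp b)
      rwa [total_ofFinsupp] at this
    have hyn : ‖ofFinsupp y‖ ≤ 6 * ‖ofFinsupp a‖ := by
      rw [hy, map_sub]
      refine (norm_sub_le _ _).trans ?_
      have := norm_ofFinsupp_single L s
      linarith
    have hφy := hL y (fun i hi => by
      by_contra hlt
      refine hi ?_
      rw [hy, hb, Finsupp.sub_apply, Finsupp.sub_apply, cutoff_apply, if_pos (by omega),
        Finsupp.single_apply, if_neg (by omega)]
      simp) (by rw [hy, map_sub, hpair, ← hs, sub_self])
    have hsingle : ∀ j t, ofFinsupp (Finsupp.single j t) = t • e j := by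
      intro j t
      rw [he, ← map_smul, Finsupp.smul_single, smul_eq_mul, mul_one]
    have hseq : s = finsuppPairing (fun _ => 1) a - ∑ j ∈ Finset.range L, a j := by
      rw [hs, hb, map_sub, hcut, map_sum]
      simp only [hpair]
    have hkey : (φ - (φ (e L) • total +
        ∑ j ∈ Finset.range L, (φ (e j) - φ (e L)) • coord j)) (ofFinsupp a) =
          φ (ofFinsupp y) := by
      have h1 : φ (ofFinsupp y) = φ (ofFinsupp a) - ∑ j ∈ Finset.range L, a j * φ (e j)
          - s * φ (e L) := by
        rw [hy, hb, hcut]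
        simp only [map_sub, map_sum, hsingle, map_smul, smul_eq_mul]
      rw [h1, hseq]
      simp only [sub_apply, add_apply, smul_apply, sum_apply, smul_eq_mul,
        total_ofFinsupp, coord_ofFinsupp, sub_mul, Finset.sum_sub_distrib]
      rw [← Finset.mul_sum, Finset.sum_congr rfl fun j _ => mul_comm (a j) (φ (e j))]
      ring
    rw [hkey, Real.norm_eq_abs]
    have h2 := mul_le_mul_of_nonneg_left hyn (by positivity : 0 ≤ ε / 6)
    linarith

theorem bidual_eq_zero (Ψ : StrongDual ℝ (StrongDual ℝ JamesTsirelson))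
    (hc : ∀ j, Ψ (coord j) = 0) (ht : Ψ total = 0) : Ψ = 0 := by
  ext φ
  show Ψ φ = 0
  rw [← abs_nonpos_iff]
  refine le_of_forall_pos_le_add fun ε hε => ?_
  obtain ⟨L, t, c, h⟩ := exists_functional_near φ (ε / (‖Ψ‖ + 1)) (by positivity)
  have h1 : Ψ φ = Ψ (φ - (t • total + ∑ j ∈ Finset.range L, c j • coord j)) := by
    simp [hc, ht]
  rw [h1, zero_add]
  refine (Ψ.le_opNorm _).trans ?_
  refine (mul_le_mul_of_nonneg_left h Ψ.opNorm_nonneg).trans ?_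
  rw [mul_div_assoc', div_le_iff₀ (by positivity)]
  nlinarith [Ψ.opNorm_nonneg]

/-- By bounded completeness it suffices to bound the chains of `Ψ (coord j)`. Pairing such a chain
with `z` in `T` is evaluating `Ψ` at a functional `ψ` of norm at most `‖z‖_T`. -/
theorem exists_seq_eq_bidual (Ψ : StrongDual ℝ (StrongDual ℝ JamesTsirelson)) :
    ∃ x : JamesTsirelson, ∀ j, coord j x = Ψ (coord j) := by
  obtain ⟨x, hx, -⟩ := exists_seq_eq_of_bounded (fun j => Ψ (coord j)) ‖Ψ‖ fun P q hP => by
    refine norm_dualComb_le _ _ _ Ψ.opNorm_nonneg fun z => ?_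
    set ψ : StrongDual ℝ JamesTsirelson :=
      ∑ p ∈ P, z p • ∑ j ∈ Finset.Icc p (q p), coord j with hψ
    have h1 : ∑ p ∈ P, (∑ j ∈ Finset.Icc p (q p), Ψ (coord j)) * z p = Ψ ψ := by
      simp only [hψ, map_sum, map_smul, smul_eq_mul]
      exact Finset.sum_congr rfl fun p _ => mul_comm _ _
    have h2 : ‖ψ‖ ≤ tsirelsonNorm z := by
      refine ContinuousLinearMap.opNorm_le_bound _ (tsirelsonNorm_nonneg z) fun x => ?_
      have h3 := abs_sum_le_dualComb P (fun p => ∑ j ∈ Finset.Icc p (q p), seq x j) z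
      have h4 : ψ x = ∑ p ∈ P, (∑ j ∈ Finset.Icc p (q p), seq x j) * z p := by
        simp only [hψ, sum_apply, smul_apply, smul_eq_mul, seq]
        exact Finset.sum_congr rfl fun p _ => mul_comm _ _
      rw [h4, Real.norm_eq_abs]
      refine h3.trans ?_
      rw [mul_comm]
      exact mul_le_mul_of_nonneg_left (norm_chainComb_seq_le hP x) (tsirelsonNorm_nonneg z)
    rw [h1]
    exact (Ψ.le_opNorm ψ).trans (mul_le_mul_of_nonneg_left h2 Ψ.opNorm_nonneg)
  exact ⟨x, fun j => congrFun hx j⟩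

/-- A weak* limit of the unit vectors along a free ultrafilter: each coordinate eventually vanishes,
while `total` is constantly `1`. -/
theorem exists_bidual_total_eq_one :
    ∃ Ψ : StrongDual ℝ (StrongDual ℝ JamesTsirelson), (∀ j, Ψ (coord j) = 0) ∧ Ψ total = 1 := by
  let e : ℕ → WeakDual ℝ (StrongDual ℝ JamesTsirelson) := fun n =>
    StrongDual.toWeakDual
      (NormedSpace.inclusionInDoubleDual ℝ JamesTsirelson (ofFinsupp (Finsupp.single n 1)))
  have heval : ∀ n (φ : StrongDual ℝ JamesTsirelson),
      e n φ = φ (ofFinsupp (Finsupp.single n 1)) := fun n φ => rfl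
  obtain ⟨Ψ, -, hΨ⟩ := (WeakDual.isCompact_closedBall
    (0 : StrongDual ℝ (StrongDual ℝ JamesTsirelson)) 1).ultrafilter_le_nhds
      ((hyperfilter ℕ).map e) (by
        rw [le_principal_iff]
        refine Filter.mem_map.2 (Filter.univ_mem' fun n => ?_)
        show _ ∈ Metric.closedBall _ _
        rw [mem_closedBall_zero_iff]
        refine (NormedSpace.double_dual_bound ℝ JamesTsirelson _).trans ?_
        simpa using norm_ofFinsupp_single n 1)
  have hlim : ∀ φ : StrongDual ℝ JamesTsirelson, Tendsto (fun n => e n φ) (hyperfilter ℕ)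
      (𝓝 (Ψ φ)) := fun φ =>
    ((WeakDual.eval_continuous φ).tendsto Ψ).comp (show Tendsto e (hyperfilter ℕ) (𝓝 Ψ) from hΨ)
  refine ⟨WeakDual.toStrongDual Ψ, fun j => ?_, ?_⟩
  · refine tendsto_nhds_unique (hlim (coord j)) (tendsto_const_nhds.congr' ?_)
    have h1 : ∀ᶠ n in (hyperfilter ℕ : Filter ℕ), j < n :=
      Nat.hyperfilter_le_atTop (eventually_gt_atTop j)
    filter_upwards [h1] with n hn
    rw [heval, coord_ofFinsupp, Finsupp.single_apply, if_neg (by omega)]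
  · refine tendsto_nhds_unique (hlim total) (tendsto_const_nhds.congr fun n => ?_)
    rw [heval, total_ofFinsupp, finsuppPairing_eq_sum _ _ {n} Finsupp.support_single_subset]
    simp

theorem eq_zero_of_coord_eq_zero (x : JamesTsirelson) (h : ∀ j, coord j x = 0) : x = 0 :=
  ext_seq (funext fun j => by
    show coord j x = coord j 0
    rw [h, map_zero])

theorem inclusion_ne_of_total_eq_one {Ψ : StrongDual ℝ (StrongDual ℝ JamesTsirelson)}
    (hc : ∀ j, Ψ (coord j) = 0) (ht : Ψ total = 1) (x : JamesTsirelson) :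
    NormedSpace.inclusionInDoubleDual ℝ JamesTsirelson x ≠ Ψ := by
  rintro rfl
  have hx : x = 0 := eq_zero_of_coord_eq_zero x hc
  rw [hx, map_zero] at ht
  exact zero_ne_one ht

theorem not_isReflexiveSpace : ¬ IsReflexiveSpace JamesTsirelson := by
  intro h
  obtain ⟨Ψ, hc, ht⟩ := exists_bidual_total_eq_one
  obtain ⟨x, hx⟩ := h Ψ
  exact inclusion_ne_of_total_eq_one hc ht x hx

theorem isQuasiReflexiveOfOrder_one : IsQuasiReflexiveOfOrder JamesTsirelson 1 := by
  obtain ⟨Ψ₀, hc, ht⟩ := exists_bidual_total_eq_one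
  set R := LinearMap.range (NormedSpace.inclusionInDoubleDual ℝ JamesTsirelson).toLinearMap with hR
  have hrank : Module.finrank ℝ (StrongDual ℝ (StrongDual ℝ JamesTsirelson) ⧸ R) = 1 := by
    refine finrank_eq_one_iff'.2 ⟨R.mkQ Ψ₀, ?_, fun w => ?_⟩
    · intro h
      rw [Submodule.mkQ_apply, Submodule.Quotient.mk_eq_zero] at h
      obtain ⟨x, hx⟩ := h
      exact inclusion_ne_of_total_eq_one hc ht x hx
    · obtain ⟨Ψ, rfl⟩ := R.mkQ_surjective w
      obtain ⟨x, hx⟩ := exists_seq_eq_bidual Ψ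
      -- `Ψ` minus the image of `x` vanishes on all coordinates, so it is the multiple of `Ψ₀` fixed
      -- by its value at `total`.
      refine ⟨Ψ total - total x, ?_⟩
      rw [← map_smul, ← sub_eq_zero, ← map_sub, Submodule.mkQ_apply,
        Submodule.Quotient.mk_eq_zero]
      refine ⟨-x, ?_⟩
      rw [ContinuousLinearMap.coe_coe, map_neg, neg_eq_iff_add_eq_zero]
      refine bidual_eq_zero _ (fun j => ?_) ?_
      · simp [hc, hx]
      · simp [ht]
  exact ⟨Module.finite_of_finrank_pos (by rw [hrank]; exact one_pos), hrank⟩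

end JamesTsirelson

/-! ### The asymptotic structure of `J[(u_i)]` -/

namespace JamesTsirelson

/-- The subspace of vectors that vanish before `L` and have total sum `0`. -/
noncomputable def tailKernel (L : ℕ) : Submodule ℝ JamesTsirelson :=
  LinearMap.ker (((ContinuousLinearMap.pi fun j : Fin L => coord j).prod total).toLinearMap)

theorem mem_tailKernel {L : ℕ} {x : JamesTsirelson} :
    x ∈ tailKernel L ↔ (∀ j < L, seq x j = 0) ∧ total x = 0 := by
  rw [tailKernel, LinearMap.mem_ker]
  simp only [ContinuousLinearMap.coe_coe, ContinuousLinearMap.prod_apply, Prod.mk_eq_zero,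
    funext_iff, ContinuousLinearMap.coe_pi', Pi.zero_apply, Fin.forall_iff]
  rfl

theorem tailKernel_mem_cofiniteSubspaces (L : ℕ) :
    tailKernel L ∈ cofiniteSubspaces JamesTsirelson := by
  refine ⟨?_, ?_⟩
  · exact ContinuousLinearMap.isClosed_ker
      ((ContinuousLinearMap.pi fun j : Fin L => coord j).prod total)
  · exact (LinearMap.quotKerEquivRange
      (((ContinuousLinearMap.pi fun j : Fin L => coord j).prod
        total).toLinearMap)).symm.finiteDimensional

/-- Against a winning vector chooser, the opponent plays `tailKernel L` with `L` past the end of the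
last approximating block. -/
theorem exists_of_vectorChooserWins (δ : ℝ) (hδ : 0 < δ) (k : ℕ) :
    ∀ (P : (Fin k → JamesTsirelson) → Prop) (L : ℕ), VectorChooserWins JamesTsirelson k P →
      ∃ (x : Fin k → JamesTsirelson) (y : Fin k → ℕ →₀ ℝ), P x ∧ IsNullBlockSeq L y ∧
        ∀ i, ‖x i‖ = 1 ∧ ‖x i - ofFinsupp (y i)‖ ≤ δ := by
  induction k with
  | zero =>
    intro P L h
    exact ⟨Fin.elim0, Fin.elim0, h, isNullBlockSeq_elim0 _ _, fun i => i.elim0⟩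
  | succ k ih =>
    intro P L h
    obtain ⟨x₀, hx₀, hx₀n, hwin⟩ := h _ (tailKernel_mem_cofiniteSubspaces L)
    rw [mem_tailKernel] at hx₀
    obtain ⟨y₀, L', hL', hy₀, hs, hnear⟩ := exists_null_block_near x₀ L (δ / 5) (by positivity)
      (by
        rw [Finset.sum_eq_zero fun j hj => by rw [hx₀.1 j (Finset.mem_range.1 hj), abs_zero]]
        positivity)
      (by
        rw [hx₀.2, abs_zero]
        positivity)
    obtain ⟨x, y, hP, hy, hxy⟩ := ih _ L' hwin
    refine ⟨Fin.cons x₀ x, Fin.cons y₀ y, hP, hy.cons hL' hy₀ hs, fun i => ?_⟩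
    refine Fin.cases ?_ (fun i => ?_) i
    · simp only [Fin.cons_zero]
      exact ⟨hx₀n, by linarith⟩
    · simp only [Fin.cons_succ]
      exact hxy i

theorem isAsymptoticC0 : IsAsymptoticC0 JamesTsirelson := by
  -- `44 = 22 * 2`. The upper bound is `11 = 5 * (1 + 1) + 1`, from null blocks with error `1 / (k +
  -- 1)`, times `B ≤ 2`. The lower bound `2` writes one coordinate as a difference of two initial
  -- segments.
  refine ⟨44, by norm_num, fun k N hN => ?_⟩
  obtain ⟨hmon, hwin⟩ := hN
  obtain ⟨x, y, ⟨A, B, hA, hB, hAB, hequiv⟩, hy, hxy⟩ :=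
    exists_of_vectorChooserWins (1 / (k + 1 : ℝ)) (by positivity) k _ k (hwin 1 one_pos)
  have hδ : (k : ℝ) * (1 / (k + 1 : ℝ)) ≤ 1 := by
    rw [mul_one_div, div_le_one (by positivity)]
    linarith
  have hδ1 : (1 / (k + 1 : ℝ)) ≤ 1 := by
    rw [div_le_one (by positivity)]
    have : (0 : ℝ) ≤ k := Nat.cast_nonneg k
    linarith
  have hδ0 : (0 : ℝ) < 1 / (k + 1 : ℝ) := by positivity
  have hcomb : ∀ a : Fin k → ℝ, combNorm x a ≤ 11 * ‖a‖ := by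
    intro a
    have h1 := norm_sum_le_of_near_nullBlocks le_rfl (fun i => a i • x i) (fun i => a i • y i)
      (hy.smul a) ‖a‖ (‖a‖ * (1 / (k + 1 : ℝ))) (by positivity) (fun i => by
        rw [norm_smul, (hxy i).1, mul_one]
        exact norm_le_pi_norm a i) (fun i => by
        rw [map_smul, ← smul_sub, norm_smul]
        exact mul_le_mul (norm_le_pi_norm a i) (hxy i).2 (norm_nonneg _) (norm_nonneg _))
        (norm_nonneg a)
    refine h1.trans ?_
    have h2 : (k : ℝ) * (‖a‖ * (1 / (k + 1 : ℝ))) ≤ ‖a‖ := by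
      calc _ = ‖a‖ * (k * (1 / (k + 1 : ℝ))) := by ring
        _ ≤ ‖a‖ * 1 := mul_le_mul_of_nonneg_left hδ (norm_nonneg a)
        _ = ‖a‖ := mul_one _
    have h3 := mul_le_mul_of_nonneg_left hδ1 (norm_nonneg a)
    linarith
  have hupper : ∀ a : Fin k → ℝ, N a ≤ 22 * ‖a‖ := by
    intro a
    rcases Nat.eq_zero_or_pos k with h0 | hk
    · subst h0
      rw [Subsingleton.elim a 0, map_zero]
      simp
    · have hA1 : 1 ≤ A := by
        have h1 := (hequiv (Pi.single ⟨0, hk⟩ 1)).1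
        have h2 : combNorm x (Pi.single ⟨0, hk⟩ 1) = 1 := by
          rw [combNorm, Finset.sum_eq_single (⟨0, hk⟩ : Fin k)
            (fun j _ hj => by rw [Pi.single_eq_of_ne hj, zero_smul])
            fun h => absurd (Finset.mem_univ _) h, Pi.single_eq_same, one_smul, (hxy _).1]
        rwa [h2, hmon.normalized, mul_one, div_le_one hA] at h1
      -- The equivalence was taken with `ε = 1`, so `A * B = 2`, and normalization gave `1 ≤ A`.
      have hB2 : B ≤ 2 := by nlinarith
      refine (hequiv a).2.trans ?_
      have h3 := mul_le_mul hB2 (hcomb a) (norm_nonneg _) zero_le_two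
      linarith
  have hlower : ∀ a : Fin k → ℝ, ‖a‖ ≤ 2 * N a := by
    intro a
    have hN0 : 0 ≤ N a := apply_nonneg N a
    refine (pi_norm_le_iff_of_nonneg (by positivity)).2 fun i => ?_
    have h1 := hmon.monotone a i
    have h2 := hmon.monotone a (i + 1)
    have h3 : (fun j : Fin k => if (j : ℕ) < i + 1 then a j else 0) -
        (fun j : Fin k => if (j : ℕ) < i then a j else 0) = a i • Pi.single i 1 := by
      funext j
      simp only [Pi.sub_apply, Pi.smul_apply, smul_eq_mul]
      rcases lt_trichotomy j i with h | h | h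
      · have h' : (j : ℕ) < i := h
        rw [if_pos (by omega), if_pos h', Pi.single_eq_of_ne h.ne]
        ring
      · subst h
        rw [if_pos (by omega), if_neg (by omega), Pi.single_eq_same]
        ring
      · have h' : (i : ℕ) < j := h
        rw [if_neg (by omega), if_neg (by omega), Pi.single_eq_of_ne h.ne']
        ring
    have h4 : N (a i • Pi.single i 1) = ‖a i‖ := by
      rw [map_smul_eq_mul, hmon.normalized, mul_one]
    rw [← h4, ← h3]
    refine (map_sub_le_add N _ _).trans ?_
    linarith
  refine ⟨22, 2, by norm_num, by norm_num, by norm_num, fun a => ⟨?_, hlower a⟩⟩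
  have := hupper a
  linarith

end JamesTsirelson

/-! ### The Hamming graphs -/

/-- The point of the Hamming graph given by a strictly increasing sequence. -/
def HammingGraph.ofStrictMono {k : ℕ} (r : Fin k → ℕ) (h : StrictMono r) : HammingGraph k :=
  ⟨Hamming.toHamming r, h⟩

theorem HammingGraph.entry_ofStrictMono {k : ℕ} (r : Fin k → ℕ) (h : StrictMono r) :
    (HammingGraph.ofStrictMono r h).entry = r := rfl

theorem HammingGraph.strictMono_entry {k : ℕ} (m : HammingGraph k) : StrictMono m.entry := m.2

theorem HammingGraph.ext_entry {k : ℕ} {m n : HammingGraph k} (h : m.entry = n.entry) : m = n :=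
  Subtype.ext (Hamming.ofHamming.injective h)

theorem HammingGraph.dist_le {k : ℕ} (m n : HammingGraph k) : dist m n ≤ k := by
  rw [HammingGraph.dist_eq]
  exact_mod_cast (Finset.card_le_univ _).trans (Fintype.card_fin k).le

theorem HammingGraph.dist_eq_of_ne {k : ℕ} (m n : HammingGraph k)
    (h : ∀ i, m.entry i ≠ n.entry i) : dist m n = k := by
  rw [HammingGraph.dist_eq, Finset.filter_true_of_mem fun i _ => h i]
  simp

theorem HammingGraph.dist_le_one {k : ℕ} (m n : HammingGraph k) (i : Fin k)
    (h : ∀ j, j ≠ i → m.entry j = n.entry j) : dist m n ≤ 1 := by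
  rw [HammingGraph.dist_eq]
  have : (Finset.univ.filter fun j => m.entry j ≠ n.entry j) ⊆ {i} := by
    intro j hj
    rw [Finset.mem_singleton]
    by_contra hne
    exact (Finset.mem_filter.1 hj).2 (h j hne)
  exact_mod_cast Finset.card_le_card this

theorem dist_le_of_expansionModulus_le {X Y : Type*} [MetricSpace X] [MetricSpace Y] {f : X → Y}
    {t w : ℝ≥0} (h : expansionModulus f t ≤ w) {x y : X} (hxy : dist x y ≤ t) :
    dist (f x) (f y) ≤ w := by
  have h0 : nndist x y ≤ t := by exact_mod_cast hxy
  have h1 : edist (f x) (f y) ≤ w :=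
    (le_iSup₂_of_le x y
      (le_iSup (fun _ : nndist x y ≤ t => edist (f x) (f y)) h0)).trans h
  rw [edist_nndist] at h1
  exact_mod_cast h1

theorem le_dist_of_le_compressionModulus {X Y : Type*} [MetricSpace X] [MetricSpace Y] {f : X → Y}
    {t w : ℝ≥0} (h : (w : ℝ≥0∞) ≤ compressionModulus f t) {x y : X} (hxy : t ≤ dist x y) :
    w ≤ dist (f x) (f y) := by
  have h0 : t ≤ nndist x y := by exact_mod_cast hxy
  have h1 : (w : ℝ≥0∞) ≤ edist (f x) (f y) :=
    h.trans (iInf₂_le_of_le x y (iInf_le_of_le h0 le_rfl))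
  rw [edist_nndist] at h1
  exact_mod_cast h1

theorem not_tendsto_of_bounded_on_pnat (ρ : ℝ≥0 → ℝ≥0) (hρ : Tendsto ρ atTop atTop) (B : ℝ)
    (h : ∀ k : ℕ+, (ρ (k : ℕ) : ℝ) ≤ B) : False := by
  obtain ⟨t, ht⟩ := eventually_atTop.1 (hρ.eventually_gt_atTop B.toNNReal)
  obtain ⟨k, hk⟩ := exists_nat_ge t
  have h1 := ht ((k + 1 : ℕ) : ℝ≥0) (hk.trans (by exact_mod_cast Nat.le_succ k))
  have h2 := h ⟨k + 1, Nat.succ_pos k⟩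
  have h3 : (B.toNNReal : ℝ) < ρ ((k + 1 : ℕ) : ℝ≥0) := by exact_mod_cast h1
  exact absurd (h3.trans_le h2) (not_lt.2 (Real.le_coe_toNNReal B))

/-! ### Iterated coordinatewise limits -/

/-- The sequence `r` is strictly increasing with all entries beyond `N`. -/
def IsIncreasingAbove (N : ℕ) {k : ℕ} (r : Fin k → ℕ) : Prop := StrictMono r ∧ ∀ i, N < r i

theorem IsIncreasingAbove.cons {N m k : ℕ} {r : Fin k → ℕ} (hm : N < m)
    (h : IsIncreasingAbove m r) : IsIncreasingAbove N (Fin.cons m r : Fin (k + 1) → ℕ) := by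
  refine ⟨fun i j hij => ?_, fun i => ?_⟩
  · revert hij
    refine Fin.cases ?_ (fun j => ?_) j
    · intro hij
      exact absurd hij (Fin.not_lt_zero i)
    · refine Fin.cases ?_ (fun i => ?_) i
      · intro _
        simpa using h.2 j
      · intro hij
        simpa using h.1 (Fin.succ_lt_succ_iff.1 hij)
  · refine Fin.cases ?_ (fun i => ?_) i
    · simpa using hm
    · simpa using hm.trans (h.2 i)

theorem IsIncreasingAbove.mono {M N k : ℕ} {r : Fin k → ℕ} (hN : M ≤ N)
    (h : IsIncreasingAbove N r) : IsIncreasingAbove M r :=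
  ⟨h.1, fun i => hN.trans_lt (h.2 i)⟩

/-- Changing one entry of an increasing sequence beyond `N` moves the value by at most `W`. -/
def IsOneStepLipschitz (W : ℝ) (N : ℕ) {k : ℕ} (F : (Fin k → ℕ) → JamesTsirelson) : Prop :=
  ∀ (i : Fin k) (r r' : Fin k → ℕ), IsIncreasingAbove N r → IsIncreasingAbove N r' →
    (∀ j, j ≠ i → r j = r' j) → ‖F r - F r'‖ ≤ W

namespace JamesTsirelson

theorem CoordTendsto.sub {ι : Type*} {z w : ι → JamesTsirelson} {U : Filter ι}
    {x y : JamesTsirelson} (hz : CoordTendsto z U x) (hw : CoordTendsto w U y) :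
    CoordTendsto (fun m => z m - w m) U (x - y) := fun j => by
  simp only [seq_sub, Pi.sub_apply]
  exact (hz j).sub (hw j)

theorem coordTendsto_const {ι : Type*} (U : Filter ι) (x : JamesTsirelson) :
    CoordTendsto (fun _ => x) U x := fun _ => tendsto_const_nhds

open Classical in
/-- The coordinatewise limit along the fixed free ultrafilter, where it exists. -/
noncomputable def coordLim (z : ℕ → JamesTsirelson) : JamesTsirelson :=
  if h : ∃ x, CoordTendsto z (hyperfilter ℕ) x then h.choose else 0

theorem coordTendsto_coordLim (z : ℕ → JamesTsirelson) (C : ℝ) (h : ∀ m, ‖z m‖ ≤ C) :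
    CoordTendsto z (hyperfilter ℕ) (coordLim z) := by
  have h1 := exists_coordTendsto (hyperfilter ℕ) z C h
  rw [coordLim, dif_pos h1]
  exact h1.choose_spec

/-- The iterated coordinatewise limit of `F`, the last variable first. -/
noncomputable def iterLim : (k : ℕ) → ((Fin k → ℕ) → JamesTsirelson) → JamesTsirelson
  | 0, F => F Fin.elim0
  | k + 1, F => coordLim fun m => iterLim k fun r => F (Fin.cons m r)

theorem norm_iterLim_le (D : ℝ) (k : ℕ) : ∀ F : (Fin k → ℕ) → JamesTsirelson,
    (∀ r, ‖F r‖ ≤ D) → ‖iterLim k F‖ ≤ D := by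
  induction k with
  | zero => exact fun F hF => hF _
  | succ k ih =>
    intro F hF
    have h : ∀ m : ℕ, ‖iterLim k fun r => F (Fin.cons m r)‖ ≤ D := fun m => ih _ fun r => hF _
    exact (coordTendsto_coordLim _ D h).norm_le D (Eventually.of_forall h)

theorem coordTendsto_iterLim {D : ℝ} {k : ℕ} (F : (Fin (k + 1) → ℕ) → JamesTsirelson)
    (hF : ∀ r, ‖F r‖ ≤ D) :
    CoordTendsto (fun m => iterLim k fun r => F (Fin.cons m r)) (hyperfilter ℕ)
      (iterLim (k + 1) F) :=
  coordTendsto_coordLim _ D fun _ => norm_iterLim_le D k _ fun _ => hF _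

theorem eventually_hyperfilter_gt (N : ℕ) : ∀ᶠ m in (hyperfilter ℕ : Filter ℕ), N < m :=
  Nat.hyperfilter_le_atTop (eventually_gt_atTop N)

/-- Iterated limits along a free ultrafilter see only increasing sequences far out. The bound `D`
merely guarantees that the limits exist and does not enter the conclusion. -/
theorem norm_iterLim_sub_le (D C : ℝ) (k : ℕ) : ∀ (F G : (Fin k → ℕ) → JamesTsirelson) (N : ℕ),
    (∀ r, ‖F r‖ ≤ D) → (∀ r, ‖G r‖ ≤ D) →
    (∀ r, IsIncreasingAbove N r → ‖F r - G r‖ ≤ C) → ‖iterLim k F - iterLim k G‖ ≤ C := by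
  induction k with
  | zero => exact fun F G N _ _ h => h _ ⟨fun i => i.elim0, fun i => i.elim0⟩
  | succ k ih =>
    intro F G N hF hG h
    refine ((coordTendsto_iterLim F hF).sub (coordTendsto_iterLim G hG)).norm_le C ?_
    filter_upwards [eventually_hyperfilter_gt N] with m hm
    exact ih _ _ m (fun _ => hF _) (fun _ => hG _) fun r hr => h _ (hr.cons hm)

/-- The iterated limits of the total sums of the successive increments of `iterLim`. -/
noncomputable def incrementTotals : (k : ℕ) → ((Fin k → ℕ) → JamesTsirelson) → Fin k → ℝ
  | 0, _ => Fin.elim0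
  | k + 1, F => Fin.cons
      (limUnder (hyperfilter ℕ : Filter ℕ) fun m =>
        total ((iterLim k fun r => F (Fin.cons m r)) - iterLim (k + 1) F))
      fun j => limUnder (hyperfilter ℕ : Filter ℕ) fun m =>
        incrementTotals k (fun r => F (Fin.cons m r)) j

theorem abs_total_increment_le {D : ℝ} {k : ℕ} (F : (Fin (k + 1) → ℕ) → JamesTsirelson)
    (hF : ∀ r, ‖F r‖ ≤ D) (m : ℕ) :
    |total ((iterLim k fun r => F (Fin.cons m r)) - iterLim (k + 1) F)| ≤ 2 * D := by
  refine (abs_total_le _).trans ((norm_sub_le _ _).trans ?_)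
  have h1 := norm_iterLim_le D k (fun r => F (Fin.cons m r)) fun r => hF _
  have h2 := norm_iterLim_le D (k + 1) F hF
  linarith

theorem tendsto_limUnder_hyperfilter (t : ℕ → ℝ) (C : ℝ) (h : ∀ m, |t m| ≤ C) :
    Tendsto t (hyperfilter ℕ) (𝓝 (limUnder (hyperfilter ℕ : Filter ℕ) t)) :=
  tendsto_nhds_limUnder ((hyperfilter ℕ).exists_tendsto_of_bounded t C h)

theorem tendsto_incrementTotals_zero {D : ℝ} {k : ℕ} (F : (Fin (k + 1) → ℕ) → JamesTsirelson)
    (hF : ∀ r, ‖F r‖ ≤ D) :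
    Tendsto (fun m => total ((iterLim k fun r => F (Fin.cons m r)) - iterLim (k + 1) F))
      (hyperfilter ℕ) (𝓝 (incrementTotals (k + 1) F 0)) :=
  tendsto_limUnder_hyperfilter _ _ (abs_total_increment_le F hF)

theorem abs_incrementTotals_le (D : ℝ) (k : ℕ) : ∀ (F : (Fin k → ℕ) → JamesTsirelson),
    (∀ r, ‖F r‖ ≤ D) → ∀ j, |incrementTotals k F j| ≤ 2 * D := by
  induction k with
  | zero => exact fun F _ j => j.elim0
  | succ k ih =>
    intro F hF j
    refine Fin.cases ?_ (fun j => ?_) j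
    · exact le_of_tendsto' (tendsto_incrementTotals_zero F hF).abs (abs_total_increment_le F hF)
    · have h : ∀ m : ℕ, |incrementTotals k (fun r => F (Fin.cons m r)) j| ≤ 2 * D := fun m =>
        ih _ (fun _ => hF _) j
      exact le_of_tendsto' (tendsto_limUnder_hyperfilter _ _ h).abs h

theorem tendsto_incrementTotals_succ {D : ℝ} {k : ℕ} (F : (Fin (k + 1) → ℕ) → JamesTsirelson)
    (hF : ∀ r, ‖F r‖ ≤ D) (j : Fin k) :
    Tendsto (fun m => incrementTotals k (fun r => F (Fin.cons m r)) j)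
      (hyperfilter ℕ) (𝓝 (incrementTotals (k + 1) F j.succ)) :=
  tendsto_limUnder_hyperfilter _ (2 * D) fun _ => abs_incrementTotals_le D k _ (fun _ => hF _) j

theorem IsOneStepLipschitz.slice {W : ℝ} {N k : ℕ} {F : (Fin (k + 1) → ℕ) → JamesTsirelson}
    (hF : IsOneStepLipschitz W N F) {m M : ℕ} (hm : N < m) (hM : m ≤ M) :
    IsOneStepLipschitz W M fun r => F (Fin.cons m r) := by
  intro i r r' hr hr' h
  refine hF i.succ _ _ ((hr.mono hM).cons hm) ((hr'.mono hM).cons hm) fun j => ?_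
  refine Fin.cases (fun _ => rfl) (fun j hj => ?_) j
  simpa using h j fun h0 => hj (by rw [h0])

/-- The increment is a limit over `n` of differences between the slices at `m` and `n`, and these
slices differ in one entry only. -/
theorem IsOneStepLipschitz.norm_increment_le {W D : ℝ} {N k : ℕ}
    {F : (Fin (k + 1) → ℕ) → JamesTsirelson} (hF : IsOneStepLipschitz W N F)
    (hD : ∀ r, ‖F r‖ ≤ D) {m : ℕ} (hm : N < m) :
    ‖(iterLim k fun r => F (Fin.cons m r)) - iterLim (k + 1) F‖ ≤ W := by
  refine ((coordTendsto_const _ _).sub (coordTendsto_iterLim F hD)).norm_le W ?_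
  filter_upwards [eventually_hyperfilter_gt N] with n hn
  refine norm_iterLim_sub_le D W k _ _ (max m n) (fun _ => hD _) (fun _ => hD _) fun r hr => ?_
  refine hF 0 _ _ ((hr.mono (le_max_left _ _)).cons hm) ((hr.mono (le_max_right _ _)).cons hn)
    fun j => ?_
  exact Fin.cases (fun h => absurd rfl h) (fun j _ => rfl) j

/-- Two functions with nearly equal increment totals have values at suitable nowhere equal
increasing sequences which deviate from the iterated limits by
nearly the same amount, up to a sum of almost null blocks. -/
theorem exists_increasing_pair (W D δ : ℝ) (k : ℕ) :
    ∀ (F G : (Fin k → ℕ) → JamesTsirelson) (N L : ℕ), (∀ r, ‖F r‖ ≤ D) → (∀ r, ‖G r‖ ≤ D) →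
      IsOneStepLipschitz W N F → IsOneStepLipschitz W N G →
      0 < δ → (∀ j, |incrementTotals k F j - incrementTotals k G j| < δ) →
      ∃ (m n : Fin k → ℕ) (x : Fin k → JamesTsirelson) (y : Fin k → ℕ →₀ ℝ),
        IsIncreasingAbove N m ∧ IsIncreasingAbove N n ∧ (∀ i, m i ≠ n i) ∧ IsNullBlockSeq L y ∧
        (∀ i, ‖x i‖ ≤ 2 * W ∧ ‖x i - ofFinsupp (y i)‖ ≤ 5 * δ) ∧
        (F m - iterLim k F) - (G n - iterLim k G) = ∑ i, x i := by
  induction k with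
  | zero =>
    intro F G N L _ _ _ _ _ _
    exact ⟨Fin.elim0, Fin.elim0, Fin.elim0, Fin.elim0, ⟨fun i => i.elim0, fun i => i.elim0⟩,
      ⟨fun i => i.elim0, fun i => i.elim0⟩, fun i => i.elim0, isNullBlockSeq_elim0 _ _,
      fun i => i.elim0, by simp [iterLim]⟩
  -- After the first entries `m ≠ n` are chosen, the remaining slices are two different functions.
  -- This is why the induction runs over pairs `F`, `G` with nearly equal totals. Strict inequality
  -- is an open condition, so it passes to the slices for almost all `m` and `n`.
  | succ k ih =>
    intro F G N L hFD hGD hF hG hδ htot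
    set U : Filter ℕ := (hyperfilter ℕ : Filter ℕ) with hU
    set a : ℕ → JamesTsirelson := fun m => (iterLim k fun r => F (Fin.cons m r)) - iterLim (k + 1) F
      with ha
    set b : ℕ → JamesTsirelson := fun n => (iterLim k fun r => G (Fin.cons n r)) - iterLim (k + 1) G
      with hb
    have ha0 : CoordTendsto a U 0 := by
      simpa using (coordTendsto_iterLim F hFD).sub (coordTendsto_const U (iterLim (k + 1) F))
    have hb0 : CoordTendsto b U 0 := by
      simpa using (coordTendsto_iterLim G hGD).sub (coordTendsto_const U (iterLim (k + 1) G))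
    have e1 : ∀ᶠ p in U ×ˢ U, |total (a p.1) - total (b p.2)| < δ :=
      ((((tendsto_incrementTotals_zero F hFD).comp tendsto_fst).sub
        ((tendsto_incrementTotals_zero G hGD).comp tendsto_snd)).abs).eventually_lt_const (htot 0)
    have e2 : ∀ᶠ p in U ×ˢ U, ∀ j : Fin k, |incrementTotals k (fun r => F (Fin.cons p.1 r)) j -
        incrementTotals k (fun r => G (Fin.cons p.2 r)) j| < δ :=
      eventually_all.2 fun j =>
        ((((tendsto_incrementTotals_succ F hFD j).comp tendsto_fst).sub
          ((tendsto_incrementTotals_succ G hGD j).comp tendsto_snd)).abs).eventually_lt_const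
            (htot j.succ)
    have e3 : ∀ᶠ p in U ×ˢ U, ∑ j ∈ Finset.range L, |seq (a p.1) j - seq (b p.2) j| < δ := by
      have h : Tendsto (fun p : ℕ × ℕ => ∑ j ∈ Finset.range L, |seq (a p.1) j - seq (b p.2) j|)
          (U ×ˢ U) (𝓝 (∑ j ∈ Finset.range L, |seq 0 j - seq 0 j|)) :=
        tendsto_finsetSum _ fun j _ =>
          (((ha0 j).comp tendsto_fst).sub ((hb0 j).comp tendsto_snd)).abs
      refine h.eventually_lt_const ?_
      simpa using hδ
    have e4 : ∀ᶠ p in U ×ˢ U, N < p.1 ∧ N < p.2 :=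
      (eventually_hyperfilter_gt N).prod_mk (eventually_hyperfilter_gt N)
    -- First `m`, then `n > m`, and later entries beyond `n`: the two vertices alternate.
    obtain ⟨m, hm⟩ := (e1.and (e2.and (e3.and e4))).curry.exists
    obtain ⟨n, ⟨h1, h2, h3, hNm, hNn⟩, hmn⟩ := (hm.and (eventually_hyperfilter_gt m)).exists
    simp only at h1 h2 h3 hNm hNn
    obtain ⟨y₀, L', hL', hy₀, hs, hnear⟩ := exists_null_block_near (a m - b n) L δ hδ
      (by
        rw [seq_sub]
        exact h3.le)
      (by
        rw [map_sub]
        exact h1.le)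
    obtain ⟨m', n', x, y, hm', hn', hne, hy, hx, hsum⟩ := ih (fun r => F (Fin.cons m r))
      (fun r => G (Fin.cons n r)) n L' (fun _ => hFD _) (fun _ => hGD _)
      (IsOneStepLipschitz.slice hF hNm hmn.le) (IsOneStepLipschitz.slice hG hNn le_rfl) hδ h2
    refine ⟨Fin.cons m m', Fin.cons n n', Fin.cons (a m - b n) x, Fin.cons y₀ y,
      (hm'.mono hmn.le).cons hNm, hn'.cons hNn, fun i => ?_, hy.cons hL' hy₀ hs, fun i => ?_, ?_⟩
    · refine Fin.cases ?_ (fun i => ?_) i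
      · simpa using hmn.ne
      · simpa using hne i
    · refine Fin.cases ?_ (fun i => ?_) i
      · simp only [Fin.cons_zero]
        refine ⟨(norm_sub_le _ _).trans ?_, hnear⟩
        have h4 := IsOneStepLipschitz.norm_increment_le hF hFD hNm
        have h5 := IsOneStepLipschitz.norm_increment_le hG hGD hNn
        linarith
      · simp only [Fin.cons_succ]
        exact hx i
    · rw [Fin.sum_univ_succ]
      simp only [Fin.cons_zero, Fin.cons_succ]
      rw [← hsum]
      simp only [ha, hb]
      abel

theorem not_equiCoarselyEmbeds :
    ¬ EquiCoarselyEmbeds (fun k : ℕ+ => HammingGraph k) JamesTsirelson := by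
  classical
  rintro ⟨ρ, ω, -, -, hρ, f, hf⟩
  -- Increment differences have norm at most `2 * ω 1`, and null blocks sum with factor `5`. The
  -- errors `5 / (k + 1)` add at most `25 + 5`, so `50` leaves slack.
  refine not_tendsto_of_bounded_on_pnat ρ hρ (10 * ω 1 + 50) fun k => ?_
  have hW : (0 : ℝ) ≤ ω 1 := (ω 1).coe_nonneg
  -- The value `0` off increasing sequences keeps `F` bounded everywhere; the Lipschitz condition
  -- tests increasing sequences only.
  let F : (Fin k → ℕ) → JamesTsirelson := fun r =>
    if h : StrictMono r then f k (HammingGraph.ofStrictMono r h) else 0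
  have hF : ∀ r (h : StrictMono r), F r = f k (HammingGraph.ofStrictMono r h) := fun r h =>
    dif_pos h
  have hFD : ∀ r, ‖F r‖ ≤ ‖f k (HammingGraph.ofStrictMono _ (Fin.val_strictMono))‖ +
      ω ((k : ℕ) : ℝ≥0) := by
    intro r
    by_cases h : StrictMono r
    · rw [hF r h]
      have h1 := dist_le_of_expansionModulus_le (hf k (k : ℕ)).2
        (x := HammingGraph.ofStrictMono r h)
        (y := HammingGraph.ofStrictMono _ Fin.val_strictMono) (by
          simpa using HammingGraph.dist_le _ _)
      rw [dist_eq_norm] at h1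
      have h2 := norm_sub_norm_le (f k (HammingGraph.ofStrictMono r h))
        (f k (HammingGraph.ofStrictMono _ (Fin.val_strictMono)))
      linarith
    · simp only [F, dif_neg h, norm_zero]
      positivity
  have hlip : IsOneStepLipschitz (ω 1) 0 F := by
    intro i r r' hr hr' h
    rw [hF r hr.1, hF r' hr'.1, ← dist_eq_norm]
    refine dist_le_of_expansionModulus_le (hf k 1).2 ?_
    rw [NNReal.coe_one]
    exact HammingGraph.dist_le_one _ _ i h
  have hk : (0 : ℝ) ≤ (k : ℕ) := Nat.cast_nonneg _
  have hδ : (0 : ℝ) < 1 / ((k : ℕ) + 1 : ℝ) := by positivity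
  have hδ1 : 1 / ((k : ℕ) + 1 : ℝ) ≤ 1 := by
    rw [div_le_one (by positivity)]
    linarith
  have hδk : (k : ℕ) * (1 / ((k : ℕ) + 1 : ℝ)) ≤ 1 := by
    rw [mul_one_div, div_le_one (by positivity)]
    linarith
  obtain ⟨m, n, x, y, hm, hn, hne, hy, hx, hsum⟩ := exists_increasing_pair (ω 1) _
    (1 / ((k : ℕ) + 1 : ℝ)) k F F 0 k hFD hFD hlip hlip hδ (fun j => by
      rw [sub_self, abs_zero]
      exact hδ)
  have h1 := norm_sum_le_of_near_nullBlocks le_rfl x y hy _ _ (by positivity)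
    (fun i => (hx i).1) (fun i => (hx i).2) (by positivity)
  rw [← hsum, sub_sub_sub_cancel_right, hF m hm.1, hF n hn.1, ← dist_eq_norm] at h1
  have h2 := le_dist_of_le_compressionModulus (hf k (k : ℕ)).1
    (x := HammingGraph.ofStrictMono m hm.1) (y := HammingGraph.ofStrictMono n hn.1) (by
      rw [HammingGraph.dist_eq_of_ne _ _ hne]
      simp)
  refine h2.trans (h1.trans ?_)
  nlinarith

end JamesTsirelson

/-! ### The concentration inequality -/

namespace HammingGraph

theorem exists_separated_pair (k : ℕ) {M : Set ℕ} (hM : M.Infinite) :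
    ∃ m ∈ subsetsOf k M, ∃ n ∈ subsetsOf k M, ∃ q, ∀ i, m.entry i ≤ q ∧ q < n.entry i := by
  have hmono : StrictMono (Nat.nth (· ∈ M)) := Nat.nth_strictMono hM
  have hmem : ∀ i, Nat.nth (· ∈ M) i ∈ M := fun i => Nat.nth_mem_of_infinite hM i
  -- Positions `0, …, k - 1` of `M` go to `m` and `k + 1, …, 2 * k` to `n`; position `k` serves as
  -- the separator `q`.
  refine ⟨ofStrictMono (fun i : Fin k => Nat.nth (· ∈ M) i) fun i j h => hmono h,
    fun i => hmem _,
    ofStrictMono (fun i : Fin k => Nat.nth (· ∈ M) (k + 1 + i)) fun i j h => hmono (by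
      have : (i : ℕ) < j := h
      omega),
    fun i => hmem _, Nat.nth (· ∈ M) k, fun i => ⟨?_, ?_⟩⟩
  · exact hmono.monotone i.2.le
  · exact hmono (by omega)

/-- Raise `m` to `n` at the largest index `i` where it is smaller. Later entries of `m` are at least
those of `n`, so the result is still increasing. -/
theorem exists_step_toward {k : ℕ} (m n : HammingGraph k) (h : ∃ i, m.entry i < n.entry i) :
    ∃ x : HammingGraph k, dist m x ≤ 1 ∧ dist x n + 1 = dist m n := by
  classical
  obtain ⟨i, hi, hmax⟩ := (Finset.univ.filter fun i => m.entry i < n.entry i).exists_max_image id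
    (by
      obtain ⟨i, hi⟩ := h
      exact ⟨i, Finset.mem_filter.2 ⟨Finset.mem_univ _, hi⟩⟩)
  replace hi := (Finset.mem_filter.1 hi).2
  have hgt : ∀ j, i < j → n.entry j ≤ m.entry j := fun j hj => by
    by_contra hlt
    exact absurd (hmax j (Finset.mem_filter.2 ⟨Finset.mem_univ _, not_le.1 hlt⟩)) (not_le.2 hj)
  have hmono : StrictMono (Function.update m.entry i (n.entry i)) := by
    intro a b hab
    by_cases ha : a = i
    · subst ha
      rw [Function.update_self, Function.update_of_ne hab.ne']
      exact (n.strictMono_entry hab).trans_le (hgt b hab)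
    · by_cases hb : b = i
      · subst hb
        rw [Function.update_self, Function.update_of_ne hab.ne]
        exact (m.strictMono_entry hab).trans hi
      · rw [Function.update_of_ne ha, Function.update_of_ne hb]
        exact m.strictMono_entry hab
  refine ⟨ofStrictMono _ hmono, dist_le_one _ _ i fun j hj => ?_, ?_⟩
  · rw [entry_ofStrictMono, Function.update_of_ne hj]
  · rw [dist_eq, dist_eq, entry_ofStrictMono]
    have : (Finset.univ.filter fun j => Function.update m.entry i (n.entry i) j ≠ n.entry j) =
        (Finset.univ.filter fun j => m.entry j ≠ n.entry j).erase i := by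
      ext j
      simp only [Finset.mem_filter, Finset.mem_univ, true_and, Finset.mem_erase]
      by_cases hj : j = i
      · subst hj
        simp
      · rw [Function.update_of_ne hj]
        simp [hj]
    rw [this]
    have h1 := Finset.card_erase_add_one (s := Finset.univ.filter fun j => m.entry j ≠ n.entry j)
      (a := i) (Finset.mem_filter.2 ⟨Finset.mem_univ _, hi.ne⟩)
    exact_mod_cast h1

/-- The Hamming metric on increasing sequences is a path metric: one of two distinct vertices can
always step toward the other. -/
theorem dist_map_le_mul {k : ℕ} {Y : Type*} [MetricSpace Y] (f : HammingGraph k → Y) (W : ℝ)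
    (hf : ∀ x y, dist x y ≤ 1 → dist (f x) (f y) ≤ W) (m n : HammingGraph k) :
    dist (f m) (f n) ≤ W * dist m n := by
  have key : ∀ (d : ℕ) (m n : HammingGraph k), dist m n = d → dist (f m) (f n) ≤ W * d := by
    intro d
    induction d with
    | zero =>
      intro m n h
      rw [Nat.cast_zero, dist_eq_zero] at h
      simp [h]
    | succ d ih =>
      intro m n h
      have step : ∀ m n : HammingGraph k, dist m n = (d + 1 : ℕ) →
          (∃ i, m.entry i < n.entry i) → dist (f m) (f n) ≤ W * (d + 1 : ℕ) := by
        intro m n h hi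
        obtain ⟨x, hx1, hx2⟩ := exists_step_toward m n hi
        have h1 := ih x n (by
          rw [h] at hx2
          push_cast at hx2
          linarith)
        have h2 := hf m x hx1
        have h3 := dist_triangle (f m) (f x) (f n)
        push_cast
        linarith
      by_cases hi : ∃ i, m.entry i < n.entry i
      · exact step m n h hi
      · rw [dist_comm (f m)]
        refine step n m (by rw [dist_comm, h]) ?_
        by_contra hi'
        push Not at hi hi'
        have : m = n := ext_entry (funext fun i => le_antisymm (hi' i) (hi i))
        rw [this, dist_self] at h
        have : (0 : ℝ) < (d + 1 : ℕ) := by positivity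
        linarith
  obtain ⟨d, hd⟩ : ∃ d : ℕ, dist m n = d := ⟨_, dist_eq m n⟩
  rw [hd]
  exact key d m n hd

theorem isBounded_image {k : ℕ} {Y : Type*} [MetricSpace Y] (f : HammingGraph k → Y) {W : ℝ}
    (hW : 0 ≤ W) (hf : ∀ m n, dist (f m) (f n) ≤ W * dist m n) (S : Set (HammingGraph k)) :
    Bornology.IsBounded (f '' S) := by
  refine Metric.isBounded_iff.2 ⟨W * k, ?_⟩
  rintro _ ⟨m, -, rfl⟩ _ ⟨n, -, rfl⟩
  exact (hf m n).trans (mul_le_mul_of_nonneg_left (dist_le m n) hW)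

end HammingGraph

theorem lipConst_le {X Y : Type*} [MetricSpace X] [MetricSpace Y] (f : X → Y) {W : ℝ}
    (hW : 0 ≤ W) (hf : ∀ x y, dist (f x) (f y) ≤ W * dist x y) : lipConst f ≤ W := by
  refine Real.sSup_le ?_ hW
  rintro _ ⟨x, y, hxy, rfl⟩
  exact (div_le_iff₀ hxy).2 (hf x y)

/-- Only one completely separated pair in `M` is needed, both to exclude embeddings and to refute
concentration for `J[(u_i)]`. -/
theorem HammingConcentration.exists_dist_le {Y : Type*} [MetricSpace Y]
    (hY : HammingConcentration Y) : ∃ C : ℝ, 0 ≤ C ∧ ∀ (k : ℕ+) (f : HammingGraph k → Y) (W : ℝ),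
      0 ≤ W → (∀ m n, dist (f m) (f n) ≤ W * dist m n) → ∃ m n : HammingGraph k,
        (∃ q, ∀ i, m.entry i ≤ q ∧ q < n.entry i) ∧ dist (f m) (f n) ≤ C * W := by
  obtain ⟨C, hC1, hC⟩ := hY
  refine ⟨C, zero_le_one.trans hC1, fun k f W hW hf => ?_⟩
  obtain ⟨M, hM, hdiam⟩ := hC k f ⟨⟨W, hW⟩, LipschitzWith.of_dist_le_mul hf⟩
  obtain ⟨m, hm, n, hn, hq⟩ := HammingGraph.exists_separated_pair k hM
  refine ⟨m, n, hq, ?_⟩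
  calc dist (f m) (f n) ≤ _ := Metric.dist_le_diam_of_mem (HammingGraph.isBounded_image f hW hf _)
        ⟨m, hm, rfl⟩ ⟨n, hn, rfl⟩
    _ ≤ _ := hdiam
    _ ≤ _ := mul_le_mul_of_nonneg_left (lipConst_le f hW hf) (zero_le_one.trans hC1)

theorem HammingConcentration.not_equiCoarselyEmbeds {Y : Type*} [MetricSpace Y]
    (hY : HammingConcentration Y) : ¬ EquiCoarselyEmbeds (fun k : ℕ+ => HammingGraph k) Y := by
  rintro ⟨ρ, ω, -, -, hρ, f, hf⟩
  obtain ⟨C, -, hC⟩ := hY.exists_dist_le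
  refine not_tendsto_of_bounded_on_pnat ρ hρ (C * ω 1) fun k => ?_
  obtain ⟨m, n, ⟨q, hq⟩, hle⟩ := hC k (f k) (ω 1) (ω 1).coe_nonneg
    (HammingGraph.dist_map_le_mul (f k) _ fun x y hxy =>
      dist_le_of_expansionModulus_le (hf k 1).2 (by rwa [NNReal.coe_one]))
  refine (le_dist_of_le_compressionModulus (hf k (k : ℕ)).1 (x := m) (y := n) ?_).trans hle
  rw [HammingGraph.dist_eq_of_ne _ _ fun i => ((hq i).1.trans_lt (hq i).2).ne]
  simp

/-! ### Failure of concentration in `J[(u_i)]` -/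

namespace JamesTsirelson

/-- The map that sends a finite set to the sum of the corresponding unit vectors. -/
noncomputable def sumUnitVectors (k : ℕ) (m : HammingGraph k) : JamesTsirelson :=
  ofFinsupp (∑ i, Finsupp.single (m.entry i) 1)

theorem dist_sumUnitVectors_le (k : ℕ) (m n : HammingGraph k) :
    dist (sumUnitVectors k m) (sumUnitVectors k n) ≤ 2 * dist m n := by
  rw [dist_eq_norm, sumUnitVectors, sumUnitVectors, ← map_sub, ← Finset.sum_sub_distrib, map_sum,
    HammingGraph.dist_eq, Finset.card_filter]
  push_cast
  rw [Finset.mul_sum]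
  refine (norm_sum_le _ _).trans (Finset.sum_le_sum fun i _ => ?_)
  split_ifs with h
  · rw [map_sub]
    refine (norm_sub_le _ _).trans ?_
    have h1 := norm_ofFinsupp_single (m.entry i) 1
    have h2 := norm_ofFinsupp_single (n.entry i) 1
    rw [abs_one] at h1 h2
    linarith
  · rw [not_not] at h
    rw [h, sub_self, map_zero, norm_zero, mul_zero]

/-- The single interval `[0, q]` sums all `k` unit vectors of `m` and none of `n`. -/
theorem le_dist_sumUnitVectors {k : ℕ} {m n : HammingGraph k} {q : ℕ}
    (hq : ∀ i, m.entry i ≤ q ∧ q < n.entry i) :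
    (k : ℝ) ≤ dist (sumUnitVectors k m) (sumUnitVectors k n) := by
  rw [dist_eq_norm, sumUnitVectors, sumUnitVectors, ← map_sub, norm_ofFinsupp]
  refine le_trans ?_ ((le_abs_self _).trans (abs_sum_Icc_le_jamesNorm _ 0 q))
  have h : ∀ r : Fin k → ℕ, ∑ j ∈ Finset.Icc 0 q, (∑ i, Finsupp.single (r i) (1 : ℝ)) j =
      ∑ i, if r i ≤ q then 1 else 0 := by
    intro r
    simp only [Finsupp.finsetSum_apply]
    rw [Finset.sum_comm]
    refine Finset.sum_congr rfl fun i _ => ?_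
    simp only [Finsupp.single_apply]
    rw [Finset.sum_ite_eq]
    simp
  simp only [Finsupp.sub_apply, Finset.sum_sub_distrib, h]
  rw [Finset.sum_congr rfl fun i _ => if_pos (hq i).1,
    Finset.sum_congr rfl fun i _ => if_neg (not_le.2 (hq i).2)]
  simp

theorem not_hammingConcentration : ¬ HammingConcentration JamesTsirelson := by
  intro h
  obtain ⟨C, hC0, hC⟩ := h.exists_dist_le
  obtain ⟨k, hk⟩ := exists_nat_gt (C * 2)
  have hk0 : 0 < k := by
    have : (0 : ℝ) < k := lt_of_le_of_lt (by positivity) hk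
    exact_mod_cast this
  obtain ⟨m, n, ⟨q, hq⟩, hle⟩ := hC ⟨k, hk0⟩ (sumUnitVectors k) 2 zero_le_two
    (dist_sumUnitVectors_le k)
  exact absurd ((le_dist_sumUnitVectors hq).trans hle) (not_le.2 hk)

end JamesTsirelson

theorem mainTheorem5 :
    -- `J[(u_i)]`, for the unit vector basis `(u_i)` of `T*`, is a Banach space,
    CompleteSpace JamesTsirelson ∧
    -- it is not reflexive,
    ¬ IsReflexiveSpace JamesTsirelson ∧
    -- it is quasi-reflexive of order one,
    IsQuasiReflexiveOfOrder JamesTsirelson 1 ∧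
    -- it is asymptotic-`c₀`,
    IsAsymptoticC0 JamesTsirelson ∧
    -- the Hamming graphs do not equi-coarsely embed into it,
    ¬ EquiCoarselyEmbeds (fun k : ℕ+ => HammingGraph k) JamesTsirelson ∧
    -- it fails the concentration inequality,
    ¬ HammingConcentration JamesTsirelson ∧
    -- whereas in every Banach space the concentration inequality prevents the equi-coarse
    -- embeddability of the Hamming graphs
    (∀ (Y : Type*) [NormedAddCommGroup Y] [NormedSpace ℝ Y] [CompleteSpace Y],
      HammingConcentration Y → ¬ EquiCoarselyEmbeds (fun k : ℕ+ => HammingGraph k) Y) := by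
  exact ⟨inferInstance, JamesTsirelson.not_isReflexiveSpace,
    JamesTsirelson.isQuasiReflexiveOfOrder_one, JamesTsirelson.isAsymptoticC0,
    JamesTsirelson.not_equiCoarselyEmbeds, JamesTsirelson.not_hammingConcentration,
    fun _ _ _ _ hY => hY.not_equiCoarselyEmbeds⟩
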